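/- Let $\mathcal H_1,\mathcal H_2$ be separable complex Hilbert spaces and let $\mathcal P_i$ be the complete lattice of orthogonal projections on $\mathcal H_i$. Let $\mathcal M(\mathcal P_1,\mathcal P_2)$ be the set of all maps $\varphi:\mathcal P_1\to\mathcal P_2$ which preserve $0$ and arbitrary suprema. For such $\varphi$ put $\mathcal S_{2\varphi}=\varphi(\mathcal P_1)$ and $\mathcal S_{1\varphi}=\{L\in\mathcal P_1:\ \text{for all }P\in\mathcal P_1,\ \varphi(P)\le\varphi(L)\text{ implies }P\le L\}$, and let $$\operatorname{Op}\varphi=\{T\in\mathcal B(\mathcal H_1,\mathcal H_2):\varphi(P)^\perp TP=0\text{ for all }P\in\mathcal P_1\}.$$ For a linear subspace $\mathcal V\subseteq\mathcal B(\mathcal H_1,\mathcal H_2)$, let $\operatorname{Map}\mathcal V\in\mathcal M(\mathcal P_1,\mathcal P_2)$ be the map sending $P$ to the projection onto the closed linear span of $\{Sx: S\in\mathcal V,\ x\in P(\mathcal H_1)\}$, and let $\varphi^\perp=\operatorname{Map}\{T\in\mathcal B(\mathcal H_1,\mathcal H_2):\varphi(L)TL^\perp=0\text{ for all }L\in\mathcal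 S_{1\varphi}\}$. A nest on $\mathcal H_i$ is a totally ordered subset of $\mathcal P_i$ which contains $0$ and $I$ and is closed under arbitrary suprema and infima. For nests $\mathcal N_1,\mathcal N_2$ on $\mathcal H_1,\mathcal H_2$ let $\mathcal M(\mathcal N_1,\mathcal N_2)$ be the set of $\varphi\in\mathcal M(\mathcal P_1,\mathcal P_2)$ with $\mathcal S_{1\varphi}\subseteq\mathcal N_1$ and $\mathcal S_{2\varphi}\subseteq\mathcal N_2$. **Theorem.** Let $\mathcal D_1\subseteq\mathcal B(\mathcal H_1)$ and $\mathcal D_2\subseteq\mathcal B(\mathcal H_2)$ be maximal abelian selfadjoint algebras, and let $\mathcal U\subseteq\mathcal B(\mathcal H_1,\mathcal H_2)$ be a w*-closed (that is, ultraweakly closed) linear subspace with $\mathcal D_2\,\mathcal U\,\mathcal D_1\subseteq\mathcal U$. Then $\mathcal U$ is normalizing, that is, $AB^*C\in\mathcal U$ for all $A,B,C\in\mathcal U$, if and only if there are nests $\mathcal N_1$ on $\mathcal H_1$ and $\mathcal N_2$ on $\mathcal H_2$ and a map $\varphi\in\mathcal M(\mathcal N_1,\mathcal N_2)$ such that $$\mathcal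 U=\operatorname{Op}\varphi\cap\operatorname{Op}\varphi^\perp .$$ -/

import Mathlib

/-!
Throughout, an orthogonal projection on a complex Hilbert space `H` is identified with its range,
so the complete lattice of projections on `H` is `ClosedSubmodule ℂ H`, with complement `Pᗮ` and
with `P.starProjection` the projection operator itself.
-/

namespace NormalizingSpace

noncomputable section

variable {H H₁ H₂ : Type*}
  [NormedAddCommGroup H] [InnerProductSpace ℂ H] [CompleteSpace H]
  [NormedAddCommGroup H₁] [InnerProductSpace ℂ H₁] [CompleteSpace H₁]
  [NormedAddCommGroup H₂] [InnerProductSpace ℂ H₂] [CompleteSpace H₂]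

/-- The complete lattice `𝒫(H)` of orthogonal projections on `H`, each given by its range. -/
abbrev Proj (H : Type*) [NormedAddCommGroup H] [InnerProductSpace ℂ H] : Type _ :=
  ClosedSubmodule ℂ H

/-- The orthogonal projection operator of `H` onto `P`. -/
abbrev proj (P : Proj H) : H →L[ℂ] H := P.toSubmodule.starProjection

/-- `𝓜(𝒫₁, 𝒫₂)`: the maps between the projection lattices which preserve arbitrary suprema (the
supremum of the empty family included, so they preserve `0`). -/
abbrev ProjMap (H₁ H₂ : Type*) [NormedAddCommGroup H₁] [InnerProductSpace ℂ H₁]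
    [NormedAddCommGroup H₂] [InnerProductSpace ℂ H₂] : Type _ :=
  sSupHom (Proj H₁) (Proj H₂)

/-- The left semilattice `S_{1φ}`: the projections that are the largest among those with
the same (or a smaller) image under `φ`. As `φ` is sup-preserving, these are the projections
`⨆ {P | φ P ≤ Q}` for `Q` in `𝒫₂`, that is, the complements of the values of the adjoint map. -/
def leftSemilattice (φ : ProjMap H₁ H₂) : Set (Proj H₁) :=
  {L | ∀ P, φ P ≤ φ L → P ≤ L}

/-- The right semilattice `S_{2φ} = φ(𝒫₁)`. -/
def rightSemilattice (φ : ProjMap H₁ H₂) : Set (Proj H₂) :=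
  Set.range φ

/-- `𝓜(𝓛₁, 𝓛₂)`: the maps in `𝓜(𝒫₁, 𝒫₂)` whose semilattices are contained in `𝓛₁` and `𝓛₂`. -/
def projMapBetween (L₁ : Set (Proj H₁)) (L₂ : Set (Proj H₂)) : Set (ProjMap H₁ H₂) :=
  {φ | leftSemilattice φ ⊆ L₁ ∧ rightSemilattice φ ⊆ L₂}

/-- A nest: a totally ordered set of projections which contains `0` and `I` and is closed under
arbitrary suprema and infima. -/
structure IsNest (N : Set (Proj H)) : Prop where
  isChain : IsChain (· ≤ ·) N
  bot_mem : ⊥ ∈ N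
  top_mem : ⊤ ∈ N
  sSup_mem : ∀ S, S ⊆ N → sSup S ∈ N
  sInf_mem : ∀ S, S ⊆ N → sInf S ∈ N

/-- `Op φ`: the space of all `T` with `φ(P)^⊥ T P = 0` for every projection `P`. -/
def Op (φ : ProjMap H₁ H₂) : Submodule ℂ (H₁ →L[ℂ] H₂) where
  carrier := {T | ∀ P : Proj H₁, proj (φ P)ᗮ ∘L T ∘L proj P = 0}
  zero_mem' := by intro P; simp
  add_mem' := by
    intro S T hS hT P
    rw [ContinuousLinearMap.add_comp, ContinuousLinearMap.comp_add, hS P, hT P, add_zero]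
  smul_mem' := by
    intro c T hT P
    rw [ContinuousLinearMap.smul_comp, ContinuousLinearMap.comp_smul, hT P, smul_zero]

/-- `Map U`: the map taking `P` to the projection onto the closed linear span of
`{S x | S ∈ U, x ∈ P}`. -/
def Map (U : Submodule ℂ (H₁ →L[ℂ] H₂)) : ProjMap H₁ H₂ where
  toFun P := (Submodule.span ℂ {y | ∃ S ∈ U, ∃ x ∈ P, S x = y}).closure
  map_sSup' := by
    intro s
    apply le_antisymm
    · rw [Submodule.closure_le, Submodule.span_le]
      rintro y ⟨S, hS, x, hx, rfl⟩
      have h : sSup s ≤ ClosedSubmodule.comap S (sSup ((fun P : Proj H₁ =>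
          (Submodule.span ℂ {y | ∃ S ∈ U, ∃ x ∈ P, S x = y}).closure) '' s)) := by
        refine sSup_le fun P hP x hx => ?_
        rw [ClosedSubmodule.mem_comap]
        exact le_sSup (Set.mem_image_of_mem (fun P : Proj H₁ =>
          (Submodule.span ℂ {y | ∃ S ∈ U, ∃ x ∈ P, S x = y}).closure) hP)
          (subset_closure (Submodule.subset_span ⟨S, hS, x, hx, rfl⟩))
      exact h hx
    · refine sSup_le ?_
      rintro _ ⟨P, hP, rfl⟩
      rw [Submodule.closure_le, Submodule.span_le]
      rintro y ⟨S, hS, x, hx, rfl⟩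
      exact subset_closure (Submodule.subset_span ⟨S, hS, x, le_sSup hP hx, rfl⟩)

/-- The space of all `T` with `φ(L) T L^⊥ = 0` for every `L` in the left semilattice of `φ`. -/
def coOp (φ : ProjMap H₁ H₂) : Submodule ℂ (H₁ →L[ℂ] H₂) where
  carrier := {T | ∀ L ∈ leftSemilattice φ, proj (φ L) ∘L T ∘L proj Lᗮ = 0}
  zero_mem' := by intro L _; simp
  add_mem' := by
    intro S T hS hT L hL
    rw [ContinuousLinearMap.add_comp, ContinuousLinearMap.comp_add, hS L hL, hT L hL, add_zero]
  smul_mem' := by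
    intro c T hT L hL
    rw [ContinuousLinearMap.smul_comp, ContinuousLinearMap.comp_smul, hT L hL, smul_zero]

/-- `φ^⊥`: the map of the space `coOp φ`. -/
def perp (φ : ProjMap H₁ H₂) : ProjMap H₁ H₂ := Map (coOp φ)

/-- A subspace is normalizing if it is closed under the triple product `(A, B, C) ↦ A B* C`. -/
def IsNormalizing (U : Submodule ℂ (H₁ →L[ℂ] H₂)) : Prop :=
  ∀ A ∈ U, ∀ B ∈ U, ∀ C ∈ U, A ∘L ContinuousLinearMap.adjoint B ∘L C ∈ U

/-- A masa: a maximal abelian selfadjoint subalgebra of the bounded operators on `H`. -/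
def IsMasa (D : StarSubalgebra ℂ (H →L[ℂ] H)) : Prop :=
  Maximal (fun A : StarSubalgebra ℂ (H →L[ℂ] H) => ∀ a ∈ A, ∀ b ∈ A, a * b = b * a) D

/-- `U` is a bimodule over `D₁` and `D₂`, that is, `D₂ U D₁ ⊆ U`. -/
def IsBimodule (D₁ : StarSubalgebra ℂ (H₁ →L[ℂ] H₁)) (D₂ : StarSubalgebra ℂ (H₂ →L[ℂ] H₂))
    (U : Submodule ℂ (H₁ →L[ℂ] H₂)) : Prop :=
  ∀ B ∈ D₂, ∀ T ∈ U, ∀ A ∈ D₁, B ∘L T ∘L A ∈ U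

/-- The w*-topology (ultraweak topology) on the bounded operators: the coarsest topology for which
every functional `T ↦ ∑ₙ ⟪yₙ, T xₙ⟫` is continuous, where `x` and `y` are square-summable
sequences of vectors. -/
abbrev wstarTopology (H₁ H₂ : Type*) [NormedAddCommGroup H₁] [InnerProductSpace ℂ H₁]
    [NormedAddCommGroup H₂] [InnerProductSpace ℂ H₂] : TopologicalSpace (H₁ →L[ℂ] H₂) :=
  ⨅ (x : lp (fun _ : ℕ => H₁) 2) (y : lp (fun _ : ℕ => H₂) 2),
    TopologicalSpace.induced (fun T : H₁ →L[ℂ] H₂ => ∑' n, inner ℂ (y n) (T (x n))) inferInstance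

/-- `U` is closed in the w*-topology. -/
def IsWStarClosed (U : Submodule ℂ (H₁ →L[ℂ] H₂)) : Prop :=
  @IsClosed _ (wstarTopology H₁ H₂) (U : Set (H₁ →L[ℂ] H₂))

end

end NormalizingSpace

/-! Sufficiency is algebra. An operator `T` lies in `Op φ ⊓ Op (perp φ)` exactly when `T L = φ(L) T`
for every `L` in the left semilattice (`mem_Op_inf_Op_perp_iff`). Taking adjoints, `B* φ(L) = L B*`,
so `A B* C` again intertwines `L` and `φ(L)`.

For necessity, let `A` be the algebra of pairs `(a, b)` with `a` and `b` in the commutants of the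
masas and `S a = b S`, `S a* = b* S` for all `S` in `U`. It is abelian because a masa contains its
commutant. A double commutant argument shows that `U` consists of all `T` with `T a = b T` on `A`:
for a vector `x` of an amplified space, the projections onto the closures of `(U*U + D₁)x` and `Ux`
are intertwined by the amplification of `U`, so their matrix entries form pairs in `A`. Hence the
amplification of `T` sends `x` into the closure of `Ux`, and w*-closedness gives `T ∈ U`.

Next, `A` is replaced by a chain. Its projections determine its intertwiners
(`map_eq_zero_of_forall_projection`), by separability countably many projections `pₙ` suffice, and
these are recovered from sums and differences of a chain of projections of `A`
(`exists_chain_of_projections`). The chain runs from `c = (ker U, 0)` to `d = (I, ran U)`, where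
`ker U` is the common kernel and `ran U` the closed span of the ranges; between these bounds each
component of an intertwined pair determines the other.

Finally the chain is enlarged to a complete chain `G` of pairs intertwined by `U`. The coordinates
of `G` form the two nests, and `φ(P)` is the second coordinate of the least member of `G` whose
first coordinate dominates `P` (`exists_nests_of_chain`). -/

namespace NormalizingSpace

/-! ### Complete chains of pairs and the sup-preserving maps they define -/

section CompleteChains

variable {α β : Type*} [CompleteLattice α] [CompleteLattice β]

/-- In a set closed under arbitrary suprema and infima, every chain extends to a complete chain. -/
theorem exists_complete_chain {X C : Set α} (hsup : ∀ s ⊆ X, sSup s ∈ X)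
    (hinf : ∀ s ⊆ X, sInf s ∈ X) (hCX : C ⊆ X) (hC : IsChain (· ≤ ·) C) :
    ∃ G, C ⊆ G ∧ G ⊆ X ∧ IsChain (· ≤ ·) G ∧ (∀ s ⊆ G, sSup s ∈ G) ∧ ∀ s ⊆ G, sInf s ∈ G := by
  obtain ⟨G, hCG, hG⟩ := zorn_subset_nonempty {D : Set α | D ⊆ X ∧ IsChain (· ≤ ·) D}
    (fun c hc hchain _ => ⟨⋃₀ c, ⟨Set.sUnion_subset fun s hs => (hc hs).1, by
      intro a ha b hb hab
      obtain ⟨s, hs, has⟩ := ha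
      obtain ⟨t, ht, hbt⟩ := hb
      rcases hchain.total hs ht with h | h
      · exact (hc ht).2 (h has) hbt hab
      · exact (hc hs).2 has (h hbt) hab⟩, fun s hs => Set.subset_sUnion_of_mem hs⟩) C ⟨hCX, hC⟩
  -- By maximality, `G` absorbs every element of `X` comparable with all of `G`; suprema and infima
  -- of subsets of `G` are such elements.
  have key : ∀ x ∈ X, (∀ g ∈ G, x ≤ g ∨ g ≤ x) → x ∈ G := by
    intro x hx h
    have : insert x G ⊆ G := hG.le_of_ge (y := insert x G)
      ⟨Set.insert_subset hx hG.prop.1, hG.prop.2.insert fun b hb _ => h b hb⟩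
      (Set.subset_insert x G)
    exact this (Set.mem_insert x G)
  refine ⟨G, hCG, hG.prop.1, hG.prop.2, fun s hs => ?_, fun s hs => ?_⟩
  · refine key _ (hsup s (hs.trans hG.prop.1)) fun g hg => ?_
    by_cases h : ∀ a ∈ s, a ≤ g
    · exact Or.inl (sSup_le h)
    · push Not at h
      obtain ⟨a, ha, hag⟩ := h
      exact Or.inr (((hG.prop.2.total (hs ha) hg).resolve_left hag).trans (le_sSup ha))
  · refine key _ (hinf s (hs.trans hG.prop.1)) fun g hg => ?_
    by_cases h : ∀ a ∈ s, g ≤ a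
    · exact Or.inr (le_sInf h)
    · push Not at h
      obtain ⟨a, ha, hag⟩ := h
      exact Or.inl ((sInf_le ha).trans ((hG.prop.2.total (hs ha) hg).resolve_right hag))

/-- The least element of `G` whose first component dominates `P`. -/
def leastAbove (G : Set (α × β)) (P : α) : α × β := sInf {g ∈ G | P ≤ g.1}

theorem le_leastAbove_fst (G : Set (α × β)) (P : α) : P ≤ (leastAbove G P).1 := by
  rw [leastAbove, Prod.fst_sInf]
  refine le_sInf ?_
  rintro _ ⟨g, hg, rfl⟩
  exact hg.2

theorem leastAbove_mem {G : Set (α × β)} (hinf : ∀ s ⊆ G, sInf s ∈ G) (P : α) :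
    leastAbove G P ∈ G := hinf _ fun _ h => h.1

theorem leastAbove_le {G : Set (α × β)} {g : α × β} (hg : g ∈ G) {P : α} (h : P ≤ g.1) :
    leastAbove G P ≤ g := sInf_le ⟨hg, h⟩

theorem leastAbove_mono (G : Set (α × β)) {P P' : α} (h : P ≤ P') :
    leastAbove G P ≤ leastAbove G P' := sInf_le_sInf fun _ hg => ⟨hg.1, h.trans hg.2⟩

/-- The supremum of the least members above each `P` in `s` belongs to `G` and dominates `sSup s`,
so it competes in the infimum on the left. -/
theorem leastAbove_sSup {G : Set (α × β)} (hsup : ∀ s ⊆ G, sSup s ∈ G)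
    (hinf : ∀ s ⊆ G, sInf s ∈ G) (s : Set α) :
    leastAbove G (sSup s) = sSup (leastAbove G '' s) := by
  apply le_antisymm
  · refine leastAbove_le (hsup _ ?_) (sSup_le fun P hP => ?_)
    · rintro _ ⟨P, _, rfl⟩
      exact leastAbove_mem hinf P
    · exact (le_leastAbove_fst G P).trans (le_sSup (Set.mem_image_of_mem (leastAbove G) hP)).1
  · refine sSup_le ?_
    rintro _ ⟨P, hP, rfl⟩
    exact leastAbove_mono G (le_sSup hP)

/-- The sup-preserving map attached to a complete chain of pairs. -/
def chainMap (G : Set (α × β)) (hsup : ∀ s ⊆ G, sSup s ∈ G) (hinf : ∀ s ⊆ G, sInf s ∈ G) :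
    sSupHom α β where
  toFun P := (leastAbove G P).2
  map_sSup' s := by
    rw [leastAbove_sSup hsup hinf, Prod.snd_sSup, Set.image_image]

end CompleteChains

/-! ### Coordinate nests and the left semilattice -/

section Nests

variable {H₁ H₂ : Type*}
  [NormedAddCommGroup H₁] [InnerProductSpace ℂ H₁]
  [NormedAddCommGroup H₂] [InnerProductSpace ℂ H₂]

theorem isNest_image_fst {G : Set (Proj H₁ × Proj H₂)} (hG : IsChain (· ≤ ·) G)
    (hsup : ∀ s ⊆ G, sSup s ∈ G) (hinf : ∀ s ⊆ G, sInf s ∈ G) : IsNest (Prod.fst '' G) := by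
  have hS : ∀ S ⊆ Prod.fst '' G, sSup S ∈ Prod.fst '' G := by
    intro S hS
    refine ⟨_, hsup (G ∩ Prod.fst ⁻¹' S) Set.inter_subset_left, ?_⟩
    rw [Prod.fst_sSup, Set.image_inter_preimage, Set.inter_eq_right.2 hS]
  have hI : ∀ S ⊆ Prod.fst '' G, sInf S ∈ Prod.fst '' G := by
    intro S hS
    refine ⟨_, hinf (G ∩ Prod.fst ⁻¹' S) Set.inter_subset_left, ?_⟩
    rw [Prod.fst_sInf, Set.image_inter_preimage, Set.inter_eq_right.2 hS]
  refine ⟨?_, ?_, ?_, hS, hI⟩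
  · rintro _ ⟨a, ha, rfl⟩ _ ⟨b, hb, rfl⟩ _
    exact (hG.total ha hb).imp And.left And.left
  · simpa using hS ∅ (Set.empty_subset _)
  · simpa using hI ∅ (Set.empty_subset _)

theorem isNest_image_snd {G : Set (Proj H₁ × Proj H₂)} (hG : IsChain (· ≤ ·) G)
    (hsup : ∀ s ⊆ G, sSup s ∈ G) (hinf : ∀ s ⊆ G, sInf s ∈ G) : IsNest (Prod.snd '' G) := by
  have hS : ∀ S ⊆ Prod.snd '' G, sSup S ∈ Prod.snd '' G := by
    intro S hS
    refine ⟨_, hsup (G ∩ Prod.snd ⁻¹' S) Set.inter_subset_left, ?_⟩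
    rw [Prod.snd_sSup, Set.image_inter_preimage, Set.inter_eq_right.2 hS]
  have hI : ∀ S ⊆ Prod.snd '' G, sInf S ∈ Prod.snd '' G := by
    intro S hS
    refine ⟨_, hinf (G ∩ Prod.snd ⁻¹' S) Set.inter_subset_left, ?_⟩
    rw [Prod.snd_sInf, Set.image_inter_preimage, Set.inter_eq_right.2 hS]
  refine ⟨?_, ?_, ?_, hS, hI⟩
  · rintro _ ⟨a, ha, rfl⟩ _ ⟨b, hb, rfl⟩ _
    exact (hG.total ha hb).imp And.right And.right
  · simpa using hS ∅ (Set.empty_subset _)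
  · simpa using hI ∅ (Set.empty_subset _)

/-- The largest projection with the same image under `φ`. -/
theorem exists_mem_leftSemilattice (φ : ProjMap H₁ H₂) (P : Proj H₁) :
    ∃ L ∈ leftSemilattice φ, P ≤ L ∧ φ L = φ P := by
  have h : φ (sSup {R | φ R ≤ φ P}) ≤ φ P := by
    rw [map_sSup]
    refine sSup_le ?_
    rintro _ ⟨R, hR, rfl⟩
    exact hR
  have hP : P ≤ sSup {R | φ R ≤ φ P} := le_sSup (show φ P ≤ φ P from le_rfl)
  exact ⟨_, fun R hR => le_sSup (show φ R ≤ φ P from hR.trans h), hP,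
    le_antisymm h (OrderHomClass.mono φ hP)⟩

end Nests

/-! ### `Op φ ⊓ Op (perp φ)` as a space of intertwiners; sufficiency -/

variable {H H₁ H₂ : Type*}
  [NormedAddCommGroup H] [InnerProductSpace ℂ H] [CompleteSpace H]
  [NormedAddCommGroup H₁] [InnerProductSpace ℂ H₁] [CompleteSpace H₁]
  [NormedAddCommGroup H₂] [InnerProductSpace ℂ H₂] [CompleteSpace H₂]

open ContinuousLinearMap (adjoint)

theorem comp_proj_eq_iff {S : H₁ →L[ℂ] H₂} {L : Proj H₁} {Q : Proj H₂} :
    S ∘L proj L = proj Q ∘L S ↔ (∀ x ∈ L, S x ∈ Q) ∧ ∀ x ∈ Lᗮ, S x ∈ Qᗮ := by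
  constructor
  · intro h
    have h' : ∀ x, S (proj L x) = proj Q (S x) := fun x => congr($h x)
    refine ⟨fun x hx => ?_, fun x hx => ?_⟩
    · have := h' x
      rw [Submodule.starProjection_eq_self_iff.2 hx] at this
      exact Submodule.starProjection_eq_self_iff.1 this.symm
    · have := h' x
      rw [(Submodule.starProjection_apply_eq_zero_iff _).2 hx, map_zero] at this
      exact (Submodule.starProjection_apply_eq_zero_iff _).1 this.symm
  · rintro ⟨h1, h2⟩
    ext x
    have h3 := h2 _ (L.toSubmodule.sub_starProjection_mem_orthogonal x)
    rw [map_sub] at h3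
    exact (Submodule.eq_starProjection_of_mem_orthogonal
      (h1 _ (L.toSubmodule.starProjection_apply_mem x)) h3).symm

theorem mapsTo_adjoint_iff {S : H₁ →L[ℂ] H₂} {L : Proj H₁} {Q : Proj H₂} :
    (∀ y ∈ Q, adjoint S y ∈ L) ↔ ∀ x ∈ Lᗮ, S x ∈ Qᗮ := by
  constructor
  · intro h x hx
    refine (Submodule.mem_orthogonal _ _).2 fun y hy => ?_
    rw [← ContinuousLinearMap.adjoint_inner_left]
    exact (Submodule.mem_orthogonal _ _).1 hx _ (h y hy)
  · intro h y hy
    rw [← ClosedSubmodule.orthogonal_orthogonal_eq L]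
    refine (Submodule.mem_orthogonal _ _).2 fun x hx => ?_
    rw [ContinuousLinearMap.adjoint_inner_right, ← inner_conj_symm,
      (Submodule.mem_orthogonal _ _).1 (h x hx) _ hy, map_zero]

theorem proj_orthogonal_comp_comp_proj_eq_zero_iff {T : H₁ →L[ℂ] H₂} {L : Proj H₁} {Q : Proj H₂} :
    proj Qᗮ ∘L T ∘L proj L = 0 ↔ ∀ x ∈ L, T x ∈ Q := by
  constructor
  · intro h x hx
    have := congr($h x)
    simp only [ContinuousLinearMap.comp_apply, _root_.zero_apply] at this
    rw [Submodule.starProjection_eq_self_iff.2 hx] at this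
    have := (Submodule.starProjection_apply_eq_zero_iff _).1 this
    rwa [← ClosedSubmodule.orthogonal_orthogonal_eq Q]
  · intro h
    ext x
    refine (Submodule.starProjection_apply_eq_zero_iff _).2 ?_
    have := h _ (L.toSubmodule.starProjection_apply_mem x)
    rwa [← ClosedSubmodule.orthogonal_orthogonal_eq Q] at this

theorem mem_Op_iff {φ : ProjMap H₁ H₂} {T : H₁ →L[ℂ] H₂} :
    T ∈ Op φ ↔ ∀ P : Proj H₁, ∀ x ∈ P, T x ∈ φ P :=
  forall_congr' fun _ => proj_orthogonal_comp_comp_proj_eq_zero_iff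

theorem mem_coOp_iff {φ : ProjMap H₁ H₂} {T : H₁ →L[ℂ] H₂} :
    T ∈ coOp φ ↔ ∀ L ∈ leftSemilattice φ, ∀ x ∈ Lᗮ, T x ∈ (φ L)ᗮ := by
  refine forall₂_congr fun L _ => ?_
  rw [← proj_orthogonal_comp_comp_proj_eq_zero_iff, ClosedSubmodule.orthogonal_orthogonal_eq]

/-- Passing to `Map` and back loses nothing here: every generator of `perp φ Lᗮ` lies in `(φ L)ᗮ`,
so the defining conditions of `coOp φ` survive. -/
theorem Op_perp (φ : ProjMap H₁ H₂) : Op (perp φ) = coOp φ := by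
  ext T
  rw [mem_Op_iff]
  constructor
  · intro h
    rw [mem_coOp_iff]
    intro L hL x hx
    have h1 : perp φ Lᗮ ≤ (φ L)ᗮ := by
      refine Submodule.closure_le.2 (Submodule.span_le.2 ?_)
      rintro _ ⟨S, hS, z, hz, rfl⟩
      exact mem_coOp_iff.1 hS L hL z hz
    exact h1 (h _ x hx)
  · intro hT P x hx
    exact subset_closure (Submodule.subset_span ⟨T, hT, x, hx, rfl⟩)

/-- `Op φ` makes `T` map `L` into `φ L`, and `coOp φ` makes it map `Lᗮ` into `(φ L)ᗮ`. Testing on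
the left semilattice suffices, since each `P` lies below some `L` there with `φ L = φ P`. -/
theorem mem_Op_inf_Op_perp_iff {φ : ProjMap H₁ H₂} {T : H₁ →L[ℂ] H₂} :
    T ∈ Op φ ⊓ Op (perp φ) ↔ ∀ L ∈ leftSemilattice φ, T ∘L proj L = proj (φ L) ∘L T := by
  rw [Op_perp, Submodule.mem_inf, mem_Op_iff, mem_coOp_iff]
  constructor
  · rintro ⟨h1, h2⟩ L hL
    exact comp_proj_eq_iff.2 ⟨h1 L, h2 L hL⟩
  · intro h
    refine ⟨fun P x hx => ?_, fun L hL => (comp_proj_eq_iff.1 (h L hL)).2⟩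
    obtain ⟨L, hL, hPL, hφ⟩ := exists_mem_leftSemilattice φ P
    rw [← hφ]
    exact (comp_proj_eq_iff.1 (h L hL)).1 x (hPL hx)

theorem adjoint_proj (P : Proj H) : adjoint (proj P) = proj P :=
  ContinuousLinearMap.isSelfAdjoint_iff'.1 (isSelfAdjoint_starProjection P.toSubmodule)

theorem isNormalizing_Op_inf_Op_perp (φ : ProjMap H₁ H₂) :
    IsNormalizing (Op φ ⊓ Op (perp φ)) := by
  intro A hA B hB C hC
  rw [mem_Op_inf_Op_perp_iff] at *
  intro L hL
  have h : adjoint B ∘L proj (φ L) = proj L ∘L adjoint B := by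
    have := congr(adjoint $(hB L hL))
    simpa only [ContinuousLinearMap.adjoint_comp, adjoint_proj] using this.symm
  rw [ContinuousLinearMap.comp_assoc, ContinuousLinearMap.comp_assoc, hC L hL,
    ← ContinuousLinearMap.comp_assoc (adjoint B), h, ← ContinuousLinearMap.comp_assoc,
    ← ContinuousLinearMap.comp_assoc, hA L hL]
  rfl

end NormalizingSpace

namespace NormalizingSpace

/-! ### Common kernel and closed span of ranges -/

section Support

variable {H₁ H₂ : Type*}
  [NormedAddCommGroup H₁] [InnerProductSpace ℂ H₁]
  [NormedAddCommGroup H₂] [InnerProductSpace ℂ H₂]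

/-- The projection onto the common kernel of the elements of `U`. -/
def kerProj (U : Set (H₁ →L[ℂ] H₂)) : Proj H₁ := ⨅ S ∈ U, ClosedSubmodule.comap S ⊥

theorem mem_kerProj {U : Set (H₁ →L[ℂ] H₂)} {x : H₁} : x ∈ kerProj U ↔ ∀ S ∈ U, S x = 0 := by
  simp [kerProj, ClosedSubmodule.mem_comap]

/-- The projection onto the closed linear span of the ranges of the elements of `U`. -/
noncomputable def rangeProj (U : Submodule ℂ (H₁ →L[ℂ] H₂)) : Proj H₂ := Map U ⊤

theorem apply_mem_rangeProj {U : Submodule ℂ (H₁ →L[ℂ] H₂)} {S : H₁ →L[ℂ] H₂} (hS : S ∈ U)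
    (x : H₁) : S x ∈ rangeProj U :=
  subset_closure (Submodule.subset_span ⟨S, hS, x, trivial, rfl⟩)

theorem rangeProj_le {U : Submodule ℂ (H₁ →L[ℂ] H₂)} {Q : Proj H₂}
    (h : ∀ S ∈ U, ∀ x, S x ∈ Q) : rangeProj U ≤ Q := by
  refine Submodule.closure_le.2 (Submodule.span_le.2 ?_)
  rintro _ ⟨S, hS, z, _, rfl⟩
  exact h S hS z

end Support

/-! ### From a chain of intertwined pairs to nests and a map -/

variable {H H₁ H₂ : Type*}
  [NormedAddCommGroup H] [InnerProductSpace ℂ H] [CompleteSpace H]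
  [NormedAddCommGroup H₁] [InnerProductSpace ℂ H₁] [CompleteSpace H₁]
  [NormedAddCommGroup H₂] [InnerProductSpace ℂ H₂] [CompleteSpace H₂]

open ContinuousLinearMap (adjoint)

/-- The pairs of projections intertwined by every element of `U`. -/
def intertwinedPairs (U : Set (H₁ →L[ℂ] H₂)) : Set (Proj H₁ × Proj H₂) :=
  {g | ∀ S ∈ U, S ∘L proj g.1 = proj g.2 ∘L S}

theorem mem_intertwinedPairs_iff {U : Set (H₁ →L[ℂ] H₂)} {g : Proj H₁ × Proj H₂} :
    g ∈ intertwinedPairs U ↔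
      ∀ S ∈ U, (∀ x ∈ g.1, S x ∈ g.2) ∧ ∀ y ∈ g.2, adjoint S y ∈ g.1 := by
  refine forall₂_congr fun S _ => ?_
  rw [comp_proj_eq_iff, mapsTo_adjoint_iff]

theorem sSup_mem_intertwinedPairs {U : Set (H₁ →L[ℂ] H₂)} {s : Set (Proj H₁ × Proj H₂)}
    (hs : s ⊆ intertwinedPairs U) : sSup s ∈ intertwinedPairs U := by
  rw [mem_intertwinedPairs_iff]
  intro S hS
  have h : ∀ g ∈ s, _ := fun g hg => mem_intertwinedPairs_iff.1 (hs hg) S hS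
  constructor
  · have : (sSup s).1 ≤ ClosedSubmodule.comap S (sSup s).2 := by
      rw [Prod.fst_sSup]
      refine sSup_le ?_
      rintro _ ⟨g, hg, rfl⟩ x hx
      exact (le_sSup hg).2 ((h g hg).1 x hx)
    exact fun x hx => this hx
  · have : (sSup s).2 ≤ ClosedSubmodule.comap (adjoint S) (sSup s).1 := by
      rw [Prod.snd_sSup]
      refine sSup_le ?_
      rintro _ ⟨g, hg, rfl⟩ x hx
      exact (le_sSup hg).1 ((h g hg).2 x hx)
    exact fun x hx => this hx

theorem sInf_mem_intertwinedPairs {U : Set (H₁ →L[ℂ] H₂)} {s : Set (Proj H₁ × Proj H₂)}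
    (hs : s ⊆ intertwinedPairs U) : sInf s ∈ intertwinedPairs U := by
  rw [mem_intertwinedPairs_iff]
  intro S hS
  have h : ∀ g ∈ s, _ := fun g hg => mem_intertwinedPairs_iff.1 (hs hg) S hS
  constructor
  · intro x hx
    rw [Prod.snd_sInf, ClosedSubmodule.mem_sInf]
    rintro _ ⟨g, hg, rfl⟩
    exact (h g hg).1 x ((sInf_le hg).1 hx)
  · intro x hx
    rw [Prod.fst_sInf, ClosedSubmodule.mem_sInf]
    rintro _ ⟨g, hg, rfl⟩
    exact (h g hg).2 x ((sInf_le hg).2 hx)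

/-- Since `g.2 S x = S g.1 x`, compressing `rangeProj U` by `g.2` lands in the closed span of `U
g.1`. Thus `g.2` is no larger than that span once it lies under `rangeProj U`. -/
theorem snd_le_of_mapsTo {U : Submodule ℂ (H₁ →L[ℂ] H₂)} {g : Proj H₁ × Proj H₂}
    (hg : g ∈ intertwinedPairs (U : Set (H₁ →L[ℂ] H₂))) (hr : g.2 ≤ rangeProj U) {Q : Proj H₂}
    (hQ : ∀ S ∈ U, ∀ x ∈ g.1, S x ∈ Q) : g.2 ≤ Q := by
  intro y hy
  have h : rangeProj U ≤ ClosedSubmodule.comap (proj g.2) Q := rangeProj_le fun S hS x => by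
    rw [ClosedSubmodule.mem_comap]
    have := congr($(hg S hS) x)
    simp only [ContinuousLinearMap.comp_apply] at this
    rw [← this]
    exact hQ S hS _ (g.1.toSubmodule.starProjection_apply_mem x)
  have h1 : proj g.2 y ∈ Q := h (hr hy)
  rwa [Submodule.starProjection_eq_self_iff.2 hy] at h1

/-- The component of `x` orthogonal to `g.1` is annihilated by all of `U`, hence lies in the common
kernel, which is contained in `g.1`. -/
theorem mem_fst_of_forall_apply_mem {U : Submodule ℂ (H₁ →L[ℂ] H₂)} {g : Proj H₁ × Proj H₂}
    (hg : g ∈ intertwinedPairs (U : Set (H₁ →L[ℂ] H₂)))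
    (hk : kerProj (U : Set (H₁ →L[ℂ] H₂)) ≤ g.1) {x : H₁} (hx : ∀ S ∈ U, S x ∈ g.2) :
    x ∈ g.1 := by
  have h : x - proj g.1 x ∈ kerProj (U : Set (H₁ →L[ℂ] H₂)) := by
    rw [mem_kerProj]
    intro S hS
    have := congr($(hg S hS) x)
    simp only [ContinuousLinearMap.comp_apply] at this
    rw [map_sub, this, Submodule.starProjection_eq_self_iff.2 (hx S hS), sub_self]
  have h2 : x - proj g.1 x + proj g.1 x ∈ g.1 :=
    add_mem (hk h) (g.1.toSubmodule.starProjection_apply_mem x)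
  rwa [sub_add_cancel] at h2

theorem exists_nests_of_chain {U : Submodule ℂ (H₁ →L[ℂ] H₂)} {C : Set (Proj H₁ × Proj H₂)}
    (hCU : C ⊆ intertwinedPairs (U : Set (H₁ →L[ℂ] H₂))) (hC : IsChain (· ≤ ·) C)
    (hlow : ∀ g ∈ C, kerProj (U : Set (H₁ →L[ℂ] H₂)) ≤ g.1)
    (hupp : ∀ g ∈ C, g.2 ≤ rangeProj U)
    (hgen : ∀ T : H₁ →L[ℂ] H₂, (∀ g ∈ C, T ∘L proj g.1 = proj g.2 ∘L T) → T ∈ U) :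
    ∃ (N₁ : Set (Proj H₁)) (N₂ : Set (Proj H₂)), IsNest N₁ ∧ IsNest N₂ ∧
      ∃ φ ∈ projMapBetween N₁ N₂, U = Op φ ⊓ Op (perp φ) := by
  obtain ⟨G, hCG, hGX, hG, hsup, hinf⟩ := exists_complete_chain
    (α := Proj H₁ × Proj H₂) (X := intertwinedPairs (U : Set (H₁ →L[ℂ] H₂)))
    (fun _ hs => sSup_mem_intertwinedPairs hs) (fun _ hs => sInf_mem_intertwinedPairs hs) hCU hC
  -- Enlarging `L` to the first coordinate of its least member of `G` does not enlarge its image, so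
  -- maximality of `L` forces equality.
  have hleft : ∀ L ∈ leftSemilattice (chainMap G hsup hinf), (leastAbove G L).1 = L := by
    intro L hL
    refine le_antisymm (hL _ ?_) (le_leastAbove_fst G L)
    exact (leastAbove_le (leastAbove_mem hinf L) le_rfl).2
  refine ⟨_, _, isNest_image_fst hG hsup hinf, isNest_image_snd hG hsup hinf,
    chainMap G hsup hinf, ⟨?_, ?_⟩, ?_⟩
  · intro L hL
    exact ⟨_, leastAbove_mem hinf L, hleft L hL⟩
  · rintro _ ⟨P, rfl⟩
    exact ⟨_, leastAbove_mem hinf P, rfl⟩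
  ext T
  rw [mem_Op_inf_Op_perp_iff]
  constructor
  · intro hT L hL
    have h := hGX (leastAbove_mem hinf L) T hT
    rwa [hleft L hL] at h
  · intro hT
    refine hgen T fun g hg => ?_
    -- A larger chain may contain pairs with the same first coordinate and a smaller second one; the
    -- bound `rangeProj U` excludes this for members of `C`. Dually, the bound by the common kernel
    -- puts `g.1` in the left semilattice.
    have hval : chainMap G hsup hinf g.1 = g.2 := by
      refine le_antisymm (leastAbove_le (hCG hg) le_rfl).2 ?_
      exact snd_le_of_mapsTo (hCU hg) (hupp g hg) fun S hS x hx =>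
        ((comp_proj_eq_iff.1 (hGX (leastAbove_mem hinf g.1) S hS)).1 x
          (le_leastAbove_fst G g.1 hx))
    have hmem : g.1 ∈ leftSemilattice (chainMap G hsup hinf) := by
      intro P hP x hx
      rw [hval] at hP
      exact mem_fst_of_forall_apply_mem (hCU hg) (hlow g hg) fun S hS => hP
        ((comp_proj_eq_iff.1 (hGX (leastAbove_mem hinf P) S hS)).1 x (le_leastAbove_fst G P hx))
    rw [hT _ hmem, hval]

end NormalizingSpace

namespace NormalizingSpace

/-! ### Generating a sequence of commuting projections by a chain -/

section IdempotentChains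

variable {R : Type*} [CommRing R]

/-- The chain between `c` and `d` obtained by successively refining with the idempotents of a
list: `p` splits the interval from `c` to `d` at `c + p * (d - c)`. -/
def refinedChain : List R → R → R → Set R
  | [], c, d => {c, d}
  | p :: ps, c, d =>
    refinedChain ps c (c + p * (d - c)) ∪ refinedChain ps (c + p * (d - c)) d

theorem left_mem_refinedChain (ps : List R) (c d : R) : c ∈ refinedChain ps c d := by
  induction ps generalizing c d with
  | nil => exact Or.inl rfl
  | cons p ps ih => exact Or.inl (ih _ _)

theorem right_mem_refinedChain (ps : List R) (c d : R) : d ∈ refinedChain ps c d := by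
  induction ps generalizing c d with
  | nil => exact Or.inr rfl
  | cons p ps ih => exact Or.inr (ih _ _)

/-- Refining by one more projection at the end of the list splits only the final intervals and keeps
every earlier point. -/
theorem refinedChain_subset_append (ps : List R) (p c d : R) :
    refinedChain ps c d ⊆ refinedChain (ps ++ [p]) c d := by
  induction ps generalizing c d with
  | nil =>
    rintro x (rfl | rfl)
    · exact left_mem_refinedChain _ _ _
    · exact right_mem_refinedChain _ _ _
  | cons q ps ih => exact Set.union_subset_union (ih _ _) (ih _ _)

/-- For the head `p`, the element is the midpoint minus `c`. A later `p` is handled on the two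
halves and the results added, as the halves sum to `d - c`. -/
theorem mul_sub_mem_of_refinedChain_subset {M : AddSubgroup R} {ps : List R} {c d : R}
    (h : refinedChain ps c d ⊆ M) {p : R} (hp : p ∈ ps) : p * (d - c) ∈ M := by
  induction ps generalizing c d with
  | nil => simp at hp
  | cons q ps ih =>
    have h1 := Set.union_subset_iff.1 h
    rcases List.mem_cons.1 hp with rfl | hp
    · have := M.sub_mem (h1.1 (right_mem_refinedChain _ _ _)) (h (left_mem_refinedChain _ _ _))
      rwa [add_sub_cancel_left] at this
    · have := M.add_mem (ih h1.1 hp) (ih h1.2 hp)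
      convert this using 1
      ring

variable [StarRing R]

/-- The element is `(1 - p) c + p d`, which agrees with `d` on `p` and with `c` off `p`. -/
theorem isStarProjection_refine {p c d : R} (hp : IsStarProjection p) (hc : IsStarProjection c)
    (hd : IsStarProjection d) : IsStarProjection (c + p * (d - c)) := by
  have h1 := hp.isIdempotentElem.eq
  have h2 := hc.isIdempotentElem.eq
  have h3 := hd.isIdempotentElem.eq
  refine ⟨?_, ?_⟩
  · change (c + p * (d - c)) * (c + p * (d - c)) = _
    linear_combination (d - c) ^ 2 * h1 + p * h3 + (1 - p) * h2
  · change star _ = _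
    simp only [star_add, star_mul', star_sub, hp.isSelfAdjoint.star_eq, hc.isSelfAdjoint.star_eq,
      hd.isSelfAdjoint.star_eq]

theorem of_mem_refinedChain {ps : List R} {c d x : R} (hps : ∀ p ∈ ps, IsStarProjection p)
    (hc : IsStarProjection c) (hd : IsStarProjection d) (hcd : c * d = c)
    (hx : x ∈ refinedChain ps c d) : IsStarProjection x ∧ c * x = c ∧ x * d = x := by
  induction ps generalizing c d with
  | nil =>
    rcases hx with rfl | rfl
    · exact ⟨hc, hc.isIdempotentElem.eq, hcd⟩
    · exact ⟨hd, hcd, hd.isIdempotentElem.eq⟩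
  | cons p ps ih =>
    have hp := hps p List.mem_cons_self
    have hm := isStarProjection_refine hp hc hd
    have h2 := hc.isIdempotentElem.eq
    have h3 := hd.isIdempotentElem.eq
    have hcm : c * (c + p * (d - c)) = c := by
      linear_combination (1 - p) * h2 + p * hcd
    have hmd : (c + p * (d - c)) * d = c + p * (d - c) := by
      linear_combination (1 - p) * hcd + p * h3
    have hps' : ∀ q ∈ ps, IsStarProjection q := fun q hq => hps q (List.mem_cons_of_mem _ hq)
    rcases hx with hx | hx
    · obtain ⟨a, b, e⟩ := ih hps' hc hm hcm hx
      refine ⟨a, b, ?_⟩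
      rw [← e, mul_assoc, hmd]
    · obtain ⟨a, b, e⟩ := ih hps' hm hd hmd hx
      refine ⟨a, ?_, e⟩
      rw [← hcm, mul_assoc, b]

theorem refinedChain_total {ps : List R} {c d x y : R} (hps : ∀ p ∈ ps, IsStarProjection p)
    (hc : IsStarProjection c) (hd : IsStarProjection d) (hcd : c * d = c)
    (hx : x ∈ refinedChain ps c d) (hy : y ∈ refinedChain ps c d) : x * y = x ∨ y * x = y := by
  induction ps generalizing c d with
  | nil =>
    rcases hx with rfl | rfl
    · exact Or.inl (of_mem_refinedChain hps hc hd hcd hy).2.1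
    · exact Or.inr (of_mem_refinedChain hps hc hd hcd hy).2.2
  | cons p ps ih =>
    have hm := isStarProjection_refine (hps p List.mem_cons_self) hc hd
    have hcm : c * (c + p * (d - c)) = c := by
      linear_combination (1 - p) * hc.isIdempotentElem.eq + p * hcd
    have hmd : (c + p * (d - c)) * d = c + p * (d - c) := by
      linear_combination (1 - p) * hcd + p * hd.isIdempotentElem.eq
    have hps' : ∀ q ∈ ps, IsStarProjection q := fun q hq => hps q (List.mem_cons_of_mem _ hq)
    have key : ∀ a b, a ∈ refinedChain ps c (c + p * (d - c)) →
        b ∈ refinedChain ps (c + p * (d - c)) d → a * b = a := by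
      intro a b ha hb
      rw [← (of_mem_refinedChain hps' hc hm hcm ha).2.2, mul_assoc,
        (of_mem_refinedChain hps' hm hd hmd hb).2.1]
    rcases hx with hx | hx <;> rcases hy with hy | hy
    · exact ih hps' hc hm hcm hx hy
    · exact Or.inl (key _ _ hx hy)
    · exact Or.inr (key _ _ hy hx)
    · exact ih hps' hm hd hmd hx hy

/-- A sequence of projections in a commutative star ring is additively generated, up to cutting
down to the interval from `c` to `d`, by a chain of projections. -/
theorem exists_chain_of_projections {c d : R} (hc : IsStarProjection c) (hd : IsStarProjection d)
    (hcd : c * d = c) {p : ℕ → R} (hp : ∀ n, IsStarProjection (p n)) :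
    ∃ C : Set R, (∀ x ∈ C, IsStarProjection x ∧ c * x = c ∧ x * d = x) ∧
      (∀ x ∈ C, ∀ y ∈ C, x * y = x ∨ y * x = y) ∧ c ∈ C ∧ d ∈ C ∧
      ∀ M : AddSubgroup R, C ⊆ M → ∀ n, p n * (d - c) ∈ M := by
  let F : ℕ → Set R := fun n => refinedChain ((List.range n).map p) c d
  have hF : Monotone F := monotone_nat_of_le_succ fun n => by
    simpa only [F, List.range_succ, List.map_append, List.map_singleton] using
      refinedChain_subset_append ((List.range n).map p) (p n) c d
  have hps : ∀ n, ∀ q ∈ (List.range n).map p, IsStarProjection q := by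
    intro n q hq
    obtain ⟨k, _, rfl⟩ := List.mem_map.1 hq
    exact hp k
  refine ⟨⋃ n, F n, ?_, ?_, ?_, ?_, ?_⟩
  · intro x hx
    obtain ⟨n, hn⟩ := Set.mem_iUnion.1 hx
    exact of_mem_refinedChain (hps n) hc hd hcd hn
  · intro x hx y hy
    obtain ⟨n, hn⟩ := Set.mem_iUnion.1 hx
    obtain ⟨m, hm⟩ := Set.mem_iUnion.1 hy
    exact refinedChain_total (hps _) hc hd hcd (hF (le_max_left n m) hn)
      (hF (le_max_right n m) hm)
  · exact Set.mem_iUnion.2 ⟨0, left_mem_refinedChain _ _ _⟩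
  · exact Set.mem_iUnion.2 ⟨0, right_mem_refinedChain _ _ _⟩
  · intro M hM n
    refine mul_sub_mem_of_refinedChain_subset
      ((Set.subset_iUnion F (n + 1)).trans hM) (List.mem_map.2 ⟨n, by simp, rfl⟩)

end IdempotentChains

end NormalizingSpace

namespace NormalizingSpace

/-! ### Range projections determine bounded linear maps -/

section SpectralApproximation

variable {R : Type*} [CStarAlgebra R]

/-- A star subalgebra which contains the range projection of each of its selfadjoint elements. -/
def HasRangeProjections (A : StarSubalgebra ℂ R) : Prop :=
  ∀ f ∈ A, IsSelfAdjoint f → ∃ p ∈ A, IsStarProjection p ∧ p * f = f ∧ ∀ g, f * g = 0 → p * g = 0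

/-- Take `p` to be the range projection of the positive part of `h`. The symmetry `s = 2p - 1`
satisfies `s|h| = h`, so `2h - s = s(2|h| - 1)`, and both factors have norm at most one. -/
theorem exists_symmetry_norm_sub_le {A : StarSubalgebra ℂ R} (hcl : IsClosed (A : Set R))
    (hA : HasRangeProjections A) {h : R} (hh : h ∈ A) (hsa : IsSelfAdjoint h) (hn : ‖h‖ ≤ 1) :
    ∃ p ∈ A, IsStarProjection p ∧ ‖2 * h - (2 * p - 1)‖ ≤ 1 := by
  let f : ℝ → ℝ := fun t => max t 0
  let g : ℝ → ℝ := fun t => max (-t) 0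
  have hfA : cfc f h ∈ A := cfc_mem (hs := hcl) f hh
  obtain ⟨p, hpA, hp, hpf, hpg⟩ := hA _ hfA (cfc_predicate f h)
  have hfg : cfc f h * cfc g h = 0 := by
    rw [← cfc_mul f g h (by fun_prop) (by fun_prop), ← cfc_zero ℝ h]
    refine cfc_congr fun t _ => ?_
    rcases le_total t 0 with ht | ht <;> simp [f, g, ht]
  have hpg' := hpg _ hfg
  have hdiff : cfc f h - cfc g h = h := by
    rw [← cfc_sub f g h (by fun_prop) (by fun_prop)]
    conv_rhs => rw [← cfc_id ℝ h]
    refine cfc_congr fun t _ => ?_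
    rcases le_total t 0 with ht | ht <;> simp [f, g, ht]
  have hk : ‖2 * (cfc f h + cfc g h) - 1‖ ≤ 1 := by
    have : 2 * (cfc f h + cfc g h) - 1 = cfc (fun t => (f t + g t) + (f t + g t) - 1) h := by
      rw [cfc_sub (fun t => (f t + g t) + (f t + g t)) (fun _ => 1) h (by fun_prop) (by fun_prop),
        cfc_add h (fun t => f t + g t) (fun t => f t + g t) (by fun_prop) (by fun_prop),
        cfc_add h f g (by fun_prop) (by fun_prop), cfc_const_one ℝ h, two_mul]
    rw [this]
    refine norm_cfc_le zero_le_one fun t ht => ?_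
    have h1 : ‖t‖ ≤ 1 := (spectrum.norm_le_norm_mul_of_mem ht).trans (by
      rcases subsingleton_or_nontrivial R with hR | hR
      · exact absurd ht (by simp [spectrum.of_subsingleton])
      · simpa using hn)
    rw [Real.norm_eq_abs, abs_le] at h1 ⊢
    rcases le_total t 0 with ht | ht <;> simp [f, g, ht] <;> linarith
  have hs : ‖2 * p - 1‖ ≤ 1 := by
    have h1 : star (2 * p - 1) * (2 * p - 1) = 1 := by
      have hp1 := hp.isIdempotentElem.eq
      rw [star_sub, star_mul, star_one, hp.isSelfAdjoint.star_eq, star_ofNat]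
      have : (p * 2 - 1) * (2 * p - 1) = 4 * (p * p) - 4 * p + 1 := by noncomm_ring
      rw [this, hp1]; simp
    have h2 := CStarRing.norm_star_mul_self (x := 2 * p - 1)
    rw [h1] at h2
    rcases subsingleton_or_nontrivial R with hR | hR
    · simp [Subsingleton.elim (2 * p - 1) 0]
    · rw [CStarRing.norm_one] at h2
      nlinarith [norm_nonneg (2 * p - 1)]
  refine ⟨p, hpA, hp, ?_⟩
  have : 2 * h - (2 * p - 1) = (2 * p - 1) * (2 * (cfc f h + cfc g h) - 1) := by
    have e : (2 * p - 1) * (2 * (cfc f h + cfc g h) - 1) =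
        2 * (2 * (p * cfc f h) - cfc f h + (2 * (p * cfc g h) - cfc g h)) - (2 * p - 1) := by
      noncomm_ring
    rw [e, hpf, hpg']
    conv_lhs => rw [← hdiff]
    noncomm_ring
  rw [this]
  exact (norm_mul_le _ _).trans (mul_le_one₀ hs (norm_nonneg _) hk)

/-- A dyadic expansion in symmetries: `N` kills `2p - 1`, so `N h` is half of `N (2h - (2p - 1))`,
whose argument is again a selfadjoint contraction in `A`. Iterating gives `‖N h‖ ≤ ‖N‖ / 2 ^ n`. -/
theorem map_eq_zero_of_forall_projection {V : Type*} [NormedAddCommGroup V] [NormedSpace ℂ V]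
    {A : StarSubalgebra ℂ R} (hcl : IsClosed (A : Set R)) (hA : HasRangeProjections A)
    (N : R →L[ℂ] V) (hN : ∀ p ∈ A, IsStarProjection p → N p = 0) {x : R} (hx : x ∈ A) :
    N x = 0 := by
  have bound : ∀ n : ℕ, ∀ h ∈ A, IsSelfAdjoint h → ‖h‖ ≤ 1 → ‖N h‖ ≤ ‖N‖ / 2 ^ n := by
    intro n
    induction n with
    | zero =>
      intro h _ _ hn
      simpa using N.le_of_opNorm_le_of_le le_rfl hn
    | succ n ih =>
      intro h hh hsa hn
      obtain ⟨p, hpA, hp, hle⟩ := exists_symmetry_norm_sub_le hcl hA hh hsa hn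
      have h2 : N (2 * h - (2 * p - 1)) = (2 : ℂ) • N h := by
        rw [two_mul, two_mul, map_sub, map_sub, map_add, map_add, hN p hpA hp,
          hN 1 (one_mem A) (.one R), two_smul]
        simp
      have hm : 2 * h - (2 * p - 1) ∈ A :=
        sub_mem (mul_mem (ofNat_mem A 2) hh) (sub_mem (mul_mem (ofNat_mem A 2) hpA) (one_mem A))
      have hs : IsSelfAdjoint (2 * h - (2 * p - 1)) := by
        rw [two_mul, two_mul]
        exact (hsa.add hsa).sub ((hp.isSelfAdjoint.add hp.isSelfAdjoint).sub (.one R))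
      have := ih _ hm hs hle
      rw [h2, norm_smul, Complex.norm_ofNat] at this
      rw [pow_succ, ← div_div]
      linarith
  have hzero : ∀ h ∈ A, IsSelfAdjoint h → ‖h‖ ≤ 1 → N h = 0 := by
    intro h hh hsa hn
    have ht : Filter.Tendsto (fun n : ℕ => ‖N‖ / 2 ^ n) Filter.atTop (nhds 0) :=
      tendsto_const_nhds.div_atTop (tendsto_pow_atTop_atTop_of_one_lt one_lt_two)
    exact norm_le_zero_iff.1 (ge_of_tendsto' ht fun n => bound n h hh hsa hn)
  have hself : ∀ h ∈ A, IsSelfAdjoint h → N h = 0 := by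
    intro h hh hsa
    have hpos : 0 < ‖h‖ + 1 := by positivity
    have h1 := hzero (((‖h‖ + 1 : ℝ) : ℂ)⁻¹ • h) (A.smul_mem hh _)
      (by rw [← Complex.ofReal_inv]; exact .smul (Complex.conj_ofReal _) hsa)
      (by rw [norm_smul, norm_inv, Complex.norm_real, Real.norm_of_nonneg hpos.le,
            inv_mul_le_one₀ hpos]; linarith)
    rw [map_smul, smul_eq_zero] at h1
    refine h1.resolve_left (inv_ne_zero ?_)
    exact_mod_cast hpos.ne'
  have hre : (realPart x : R) ∈ A := by
    rw [realPart_apply_coe, ← Complex.coe_smul]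
    exact A.smul_mem (add_mem hx (star_mem hx)) _
  have him : (imaginaryPart x : R) ∈ A := by
    rw [imaginaryPart_apply_coe, ← Complex.coe_smul]
    exact A.smul_mem (A.smul_mem (sub_mem hx (star_mem hx)) _) _
  rw [← realPart_add_I_smul_imaginaryPart x, map_add, map_smul, hself _ hre (realPart x).2,
    hself _ him (imaginaryPart x).2, smul_zero, add_zero]

end SpectralApproximation

/-! ### A masa contains its commutant -/

section Masa

variable {H : Type*} [NormedAddCommGroup H] [InnerProductSpace ℂ H] [CompleteSpace H]

/-- Adjoining `x` to `D` keeps the star algebra commutative, so maximality absorbs it. -/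
theorem IsMasa.mem_of_isSelfAdjoint {D : StarSubalgebra ℂ (H →L[ℂ] H)} (hD : IsMasa D)
    {x : H →L[ℂ] H} (hx : IsSelfAdjoint x) (hcomm : ∀ d ∈ D, d * x = x * d) : x ∈ D := by
  have hc := StarAlgebra.isMulCommutative_adjoin ℂ (s := insert x (D : Set (H →L[ℂ] H)))
    (by
      rintro a (rfl | ha) b (rfl | hb)
      · rfl
      · exact (hcomm b hb).symm
      · exact hcomm a ha
      · exact hD.prop a ha b hb)
    (by
      rintro a (rfl | ha) b (rfl | hb)
      · rw [hx.star_eq]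
      · exact (hcomm _ (star_mem hb)).symm
      · rw [hx.star_eq]; exact hcomm a ha
      · exact hD.prop a ha _ (star_mem hb))
  have hle := hD.le_of_ge (y := StarAlgebra.adjoin ℂ (insert x (D : Set (H →L[ℂ] H))))
    (fun a ha b hb => setLike_mul_comm ha hb)
    (fun a ha => StarAlgebra.subset_adjoin ℂ _ (Set.mem_insert_of_mem _ ha))
  exact hle (StarAlgebra.subset_adjoin ℂ _ (Set.mem_insert _ _))

theorem IsMasa.mem_of_commute {D : StarSubalgebra ℂ (H →L[ℂ] H)} (hD : IsMasa D)
    {x : H →L[ℂ] H} (hcomm : ∀ d ∈ D, d * x = x * d) : x ∈ D := by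
  have hstar : ∀ d ∈ D, d * star x = star x * d := by
    intro d hd
    have := congr(star $(hcomm _ (star_mem hd)))
    simpa using this.symm
  have hre : (realPart x : H →L[ℂ] H) ∈ D := by
    refine hD.mem_of_isSelfAdjoint (realPart x).2 fun d hd => ?_
    rw [realPart_apply_coe, mul_smul_comm, smul_mul_assoc, mul_add, add_mul, hcomm d hd, hstar d hd]
  have him : (imaginaryPart x : H →L[ℂ] H) ∈ D := by
    refine hD.mem_of_isSelfAdjoint (imaginaryPart x).2 fun d hd => ?_
    rw [imaginaryPart_apply_coe, mul_smul_comm, mul_smul_comm, smul_mul_assoc, smul_mul_assoc,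
      mul_sub, sub_mul, hcomm d hd, hstar d hd]
  rw [← realPart_add_I_smul_imaginaryPart x]
  exact add_mem hre (D.smul_mem him _)

end Masa

end NormalizingSpace

namespace NormalizingSpace

/-! ### The algebra of intertwined pairs and its projections -/

section Ranges

variable {H H₁ H₂ : Type*} [NormedAddCommGroup H] [InnerProductSpace ℂ H]
  [NormedAddCommGroup H₁] [InnerProductSpace ℂ H₁]
  [NormedAddCommGroup H₂] [InnerProductSpace ℂ H₂]

/-- The map `x ↦ S x.1 - x.2 S`, which measures how far `S` is from intertwining `x`. -/
noncomputable def intertwiningDefect (S : H₁ →L[ℂ] H₂) :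
    (H₁ →L[ℂ] H₁) × (H₂ →L[ℂ] H₂) →L[ℂ] (H₁ →L[ℂ] H₂) :=
  (ContinuousLinearMap.compL ℂ H₁ H₁ H₂ S) ∘L (ContinuousLinearMap.fst ℂ _ _) -
    ((ContinuousLinearMap.compL ℂ H₁ H₂ H₂).flip S) ∘L (ContinuousLinearMap.snd ℂ _ _)

theorem intertwiningDefect_eq_zero_iff {S : H₁ →L[ℂ] H₂}
    {x : (H₁ →L[ℂ] H₁) × (H₂ →L[ℂ] H₂)} :
    intertwiningDefect S x = 0 ↔ S ∘L x.1 = x.2 ∘L S := by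
  simp [intertwiningDefect, sub_eq_zero]

/-- The projection onto the closure of the range of an operator. -/
noncomputable def rangeClosure (f : H →L[ℂ] H) : Proj H := (LinearMap.range f.toLinearMap).closure

theorem apply_mem_rangeClosure (f : H →L[ℂ] H) (x : H) : f x ∈ rangeClosure f :=
  subset_closure ⟨x, rfl⟩

theorem rangeClosure_le {f : H →L[ℂ] H} {P : Proj H} (h : ∀ x, f x ∈ P) : rangeClosure f ≤ P := by
  refine Submodule.closure_le.2 ?_
  rintro _ ⟨x, rfl⟩
  exact h x

end Ranges

variable {H H₁ H₂ : Type*}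
  [NormedAddCommGroup H] [InnerProductSpace ℂ H] [CompleteSpace H]
  [NormedAddCommGroup H₁] [InnerProductSpace ℂ H₁] [CompleteSpace H₁]
  [NormedAddCommGroup H₂] [InnerProductSpace ℂ H₂] [CompleteSpace H₂]

open ContinuousLinearMap (adjoint)

/-- The star algebra of all pairs `x` such that `S` intertwines both `x` and `x*`. -/
def intertwinerAlgebra (S : H₁ →L[ℂ] H₂) :
    StarSubalgebra ℂ ((H₁ →L[ℂ] H₁) × (H₂ →L[ℂ] H₂)) where
  carrier := {x | S ∘L x.1 = x.2 ∘L S ∧ S ∘L star x.1 = star x.2 ∘L S}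
  mul_mem' := by
    rintro x y ⟨hx, hx'⟩ ⟨hy, hy'⟩
    constructor
    · rw [Prod.fst_mul, Prod.snd_mul, ContinuousLinearMap.mul_def, ContinuousLinearMap.mul_def,
        ← ContinuousLinearMap.comp_assoc, hx, ContinuousLinearMap.comp_assoc, hy,
        ContinuousLinearMap.comp_assoc]
    · rw [Prod.fst_mul, Prod.snd_mul, star_mul, star_mul, ContinuousLinearMap.mul_def,
        ContinuousLinearMap.mul_def, ← ContinuousLinearMap.comp_assoc, hy',
        ContinuousLinearMap.comp_assoc, hx', ContinuousLinearMap.comp_assoc]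
  add_mem' := by
    rintro x y ⟨hx, hx'⟩ ⟨hy, hy'⟩
    constructor
    · rw [Prod.fst_add, Prod.snd_add, ContinuousLinearMap.comp_add, ContinuousLinearMap.add_comp,
        hx, hy]
    · rw [Prod.fst_add, Prod.snd_add, star_add, star_add, ContinuousLinearMap.comp_add,
        ContinuousLinearMap.add_comp, hx', hy']
  algebraMap_mem' := by
    intro c
    constructor
    · ext v; simp [Algebra.algebraMap_eq_smul_one]
    · ext v; simp [Algebra.algebraMap_eq_smul_one]
  star_mem' := by
    rintro x ⟨hx, hx'⟩
    exact ⟨hx', by rw [Prod.fst_star, Prod.snd_star, star_star, star_star, hx]⟩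

theorem mem_intertwinerAlgebra_iff {S : H₁ →L[ℂ] H₂} {x : (H₁ →L[ℂ] H₁) × (H₂ →L[ℂ] H₂)} :
    x ∈ intertwinerAlgebra S ↔ S ∘L x.1 = x.2 ∘L S ∧ S ∘L star x.1 = star x.2 ∘L S := Iff.rfl

theorem isClosed_intertwinerAlgebra (S : H₁ →L[ℂ] H₂) :
    IsClosed (intertwinerAlgebra S : Set ((H₁ →L[ℂ] H₁) × (H₂ →L[ℂ] H₂))) := by
  have h : (intertwinerAlgebra S : Set ((H₁ →L[ℂ] H₁) × (H₂ →L[ℂ] H₂))) =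
      {x | intertwiningDefect S x = 0} ∩ {x | intertwiningDefect S (star x) = 0} := by
    ext x
    simp only [Set.mem_inter_iff, Set.mem_ofPred_eq, intertwiningDefect_eq_zero_iff]
    rfl
  rw [h]
  exact (isClosed_eq (by fun_prop) continuous_const).inter
    (isClosed_eq ((intertwiningDefect S).continuous.comp continuous_star) continuous_const)

theorem proj_rangeClosure_mul (f : H →L[ℂ] H) : proj (rangeClosure f) * f = f := by
  ext x
  exact Submodule.starProjection_eq_self_iff.2 (apply_mem_rangeClosure f x)

theorem proj_rangeClosure_mul_eq_zero {f g : H →L[ℂ] H} (hf : IsSelfAdjoint f) (h : f * g = 0) :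
    proj (rangeClosure f) * g = 0 := by
  ext x
  refine (Submodule.starProjection_apply_eq_zero_iff _).2 ?_
  have hle : rangeClosure f ≤ (ℂ ∙ g x).closureᗮ := rangeClosure_le fun z => by
    rw [ClosedSubmodule.orthogonal_closure']
    refine Submodule.mem_orthogonal_singleton_iff_inner_right.2 ?_
    rw [← hf.adjoint_eq, ContinuousLinearMap.adjoint_inner_right]
    have : f (g x) = 0 := congr($h x)
    rw [this, inner_zero_left]
  refine (Submodule.mem_orthogonal _ _).2 fun u hu => ?_
  have h1 := hle hu
  rw [ClosedSubmodule.orthogonal_closure'] at h1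
  exact Submodule.mem_orthogonal_singleton_iff_inner_left.1 h1

theorem adjoint_comp_snd_of_mem_intertwinerAlgebra {S : H₁ →L[ℂ] H₂}
    {x : (H₁ →L[ℂ] H₁) × (H₂ →L[ℂ] H₂)} (hx : x ∈ intertwinerAlgebra S) :
    adjoint S ∘L x.2 = x.1 ∘L adjoint S := by
  have h := congr(adjoint $(hx.2))
  rw [ContinuousLinearMap.adjoint_comp, ContinuousLinearMap.adjoint_comp,
    ContinuousLinearMap.star_eq_adjoint, ContinuousLinearMap.star_eq_adjoint,
    ContinuousLinearMap.adjoint_adjoint, ContinuousLinearMap.adjoint_adjoint] at h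
  exact h.symm

/-- `S` carries the range of `x.1` into that of `x.2`, and `S*` carries it back because `S` also
intertwines the adjoints. -/
theorem comp_proj_rangeClosure {S : H₁ →L[ℂ] H₂} {x : (H₁ →L[ℂ] H₁) × (H₂ →L[ℂ] H₂)}
    (hx : x ∈ intertwinerAlgebra S) :
    S ∘L proj (rangeClosure x.1) = proj (rangeClosure x.2) ∘L S := by
  rw [comp_proj_eq_iff, ← mapsTo_adjoint_iff]
  constructor
  · have : rangeClosure x.1 ≤ ClosedSubmodule.comap S (rangeClosure x.2) := by
      refine rangeClosure_le fun z => ?_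
      rw [ClosedSubmodule.mem_comap]
      have h : S (x.1 z) = x.2 (S z) := congr($(hx.1) z)
      rw [h]
      exact apply_mem_rangeClosure _ _
    exact fun z hz => this hz
  · have : rangeClosure x.2 ≤ ClosedSubmodule.comap (adjoint S) (rangeClosure x.1) := by
      refine rangeClosure_le fun z => ?_
      rw [ClosedSubmodule.mem_comap]
      have h : adjoint S (x.2 z) = x.1 (adjoint S z) :=
        congr($(adjoint_comp_snd_of_mem_intertwinerAlgebra hx) z)
      rw [h]
      exact apply_mem_rangeClosure _ _
    exact fun z hz => this hz

/-- The pair of projection operators given by a pair of closed subspaces. -/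
noncomputable def projPair (g : Proj H₁ × Proj H₂) : (H₁ →L[ℂ] H₁) × (H₂ →L[ℂ] H₂) :=
  (proj g.1, proj g.2)

theorem isStarProjection_projPair (g : Proj H₁ × Proj H₂) : IsStarProjection (projPair g) :=
  ⟨Prod.ext g.1.toSubmodule.isIdempotentElem_starProjection
    g.2.toSubmodule.isIdempotentElem_starProjection,
   Prod.ext (isSelfAdjoint_starProjection _) (isSelfAdjoint_starProjection _)⟩

theorem exists_proj_eq {p : H →L[ℂ] H} (hp : IsStarProjection p) : ∃ P : Proj H, proj P = p := by
  obtain ⟨K, hK, rfl⟩ := isStarProjection_iff_eq_starProjection.1 hp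
  refine ⟨⟨K, ?_⟩, rfl⟩
  rw [← Submodule.orthogonal_orthogonal K]
  exact Submodule.isClosed_orthogonal _

theorem exists_projPair_eq {p : (H₁ →L[ℂ] H₁) × (H₂ →L[ℂ] H₂)} (hp : IsStarProjection p) :
    ∃ g, projPair g = p := by
  obtain ⟨P, hP⟩ := exists_proj_eq (p := p.1)
    ⟨congr(Prod.fst $hp.isIdempotentElem.eq), congr(Prod.fst $hp.isSelfAdjoint.star_eq)⟩
  obtain ⟨Q, hQ⟩ := exists_proj_eq (p := p.2)
    ⟨congr(Prod.snd $hp.isIdempotentElem.eq), congr(Prod.snd $hp.isSelfAdjoint.star_eq)⟩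
  exact ⟨(P, Q), Prod.ext hP hQ⟩

theorem projPair_mem_intertwinerAlgebra_iff {S : H₁ →L[ℂ] H₂} {g : Proj H₁ × Proj H₂} :
    projPair g ∈ intertwinerAlgebra S ↔ S ∘L proj g.1 = proj g.2 ∘L S := by
  rw [mem_intertwinerAlgebra_iff, ← Prod.fst_star, ← Prod.snd_star,
    (isStarProjection_projPair g).isSelfAdjoint.star_eq]
  exact and_self_iff

theorem le_of_proj_mul_eq {P Q : Proj H} (h : proj Q * proj P = proj P) : P ≤ Q := by
  intro x hx
  have h1 : proj Q (proj P x) = proj P x := congr($h x)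
  rw [Submodule.starProjection_eq_self_iff.2 hx] at h1
  exact Submodule.starProjection_eq_self_iff.1 h1

/-- The pairs of operators, in the commutants of `D₁` and `D₂`, which are intertwined together
with their adjoints by all elements of `U`: the commutant of the linking algebra of `U`. -/
noncomputable def pairAlgebra (D₁ : StarSubalgebra ℂ (H₁ →L[ℂ] H₁)) (D₂ : StarSubalgebra ℂ (H₂ →L[ℂ] H₂))
    (U : Set (H₁ →L[ℂ] H₂)) : StarSubalgebra ℂ ((H₁ →L[ℂ] H₁) × (H₂ →L[ℂ] H₂)) :=
  (⨅ d ∈ D₁, (intertwinerAlgebra d).comap ((StarAlgHom.fst ℂ _ _).prod (StarAlgHom.fst ℂ _ _))) ⊓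
  (⨅ d ∈ D₂, (intertwinerAlgebra d).comap ((StarAlgHom.snd ℂ _ _).prod (StarAlgHom.snd ℂ _ _))) ⊓
  ⨅ S ∈ U, intertwinerAlgebra S

section PairAlgebra

variable {D₁ : StarSubalgebra ℂ (H₁ →L[ℂ] H₁)} {D₂ : StarSubalgebra ℂ (H₂ →L[ℂ] H₂)}
  {U : Set (H₁ →L[ℂ] H₂)}

theorem mem_pairAlgebra_iff {x : (H₁ →L[ℂ] H₁) × (H₂ →L[ℂ] H₂)} :
    x ∈ pairAlgebra D₁ D₂ U ↔ (∀ d ∈ D₁, (x.1, x.1) ∈ intertwinerAlgebra d) ∧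
      (∀ d ∈ D₂, (x.2, x.2) ∈ intertwinerAlgebra d) ∧ ∀ S ∈ U, x ∈ intertwinerAlgebra S := by
  simp only [pairAlgebra, StarSubalgebra.mem_inf, StarSubalgebra.mem_iInf, StarSubalgebra.mem_comap,
    StarAlgHom.prod_apply, StarAlgHom.fst_apply, StarAlgHom.snd_apply, and_assoc]

theorem isClosed_pairAlgebra :
    IsClosed (pairAlgebra D₁ D₂ U : Set ((H₁ →L[ℂ] H₁) × (H₂ →L[ℂ] H₂))) := by
  have h : (pairAlgebra D₁ D₂ U : Set ((H₁ →L[ℂ] H₁) × (H₂ →L[ℂ] H₂))) =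
      (⋂ d ∈ D₁, (fun x => (x.1, x.1)) ⁻¹' (intertwinerAlgebra d : Set _)) ∩
      ((⋂ d ∈ D₂, (fun x => (x.2, x.2)) ⁻¹' (intertwinerAlgebra d : Set _)) ∩
      ⋂ S ∈ U, (intertwinerAlgebra S : Set _)) := by
    ext x
    simp [mem_pairAlgebra_iff]
  rw [h]
  refine .inter (isClosed_biInter fun d _ => ?_) (.inter (isClosed_biInter fun d _ => ?_)
    (isClosed_biInter fun S _ => isClosed_intertwinerAlgebra S))
  · exact (isClosed_intertwinerAlgebra d).preimage (by fun_prop)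
  · exact (isClosed_intertwinerAlgebra d).preimage (by fun_prop)

theorem hasRangeProjections_pairAlgebra : HasRangeProjections (pairAlgebra D₁ D₂ U) := by
  intro f hf hsa
  rw [mem_pairAlgebra_iff] at hf
  have h1 : IsSelfAdjoint f.1 := congr(Prod.fst $hsa.star_eq)
  have h2 : IsSelfAdjoint f.2 := congr(Prod.snd $hsa.star_eq)
  refine ⟨projPair (rangeClosure f.1, rangeClosure f.2), mem_pairAlgebra_iff.2 ⟨?_, ?_, ?_⟩,
    isStarProjection_projPair _,
    Prod.ext (proj_rangeClosure_mul _) (proj_rangeClosure_mul _), ?_⟩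
  · exact fun d hd => (projPair_mem_intertwinerAlgebra_iff
      (g := (rangeClosure f.1, rangeClosure f.1))).2 (comp_proj_rangeClosure (x := (f.1, f.1)) (hf.1 d hd))
  · exact fun d hd => (projPair_mem_intertwinerAlgebra_iff
      (g := (rangeClosure f.2, rangeClosure f.2))).2 (comp_proj_rangeClosure (x := (f.2, f.2)) (hf.2.1 d hd))
  · exact fun S hS => projPair_mem_intertwinerAlgebra_iff.2 (comp_proj_rangeClosure (hf.2.2 S hS))
  · intro g hg
    exact Prod.ext (proj_rangeClosure_mul_eq_zero h1 congr(Prod.fst $hg))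
      (proj_rangeClosure_mul_eq_zero h2 congr(Prod.snd $hg))

/-- The coordinates of `x` commute with the masas, hence belong to them, and the coordinates of `y`
commute with the masas. -/
theorem isMulCommutative_pairAlgebra (hD₁ : IsMasa D₁) (hD₂ : IsMasa D₂) :
    IsMulCommutative (pairAlgebra D₁ D₂ U) := by
  refine .of_setLike_mul_comm fun x hx y hy => Prod.ext ?_ ?_
  · exact (((mem_pairAlgebra_iff.1 hy).1 _ (hD₁.mem_of_commute fun d hd => ((mem_pairAlgebra_iff.1 hx).1 d hd).1)).1)
  · exact (((mem_pairAlgebra_iff.1 hy).2.1 _ (hD₂.mem_of_commute fun d hd => ((mem_pairAlgebra_iff.1 hx).2.1 d hd).1)).1)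

theorem comp_fst_eq_of_forall_projPair {T : H₁ →L[ℂ] H₂}
    (hT : ∀ g, projPair g ∈ pairAlgebra D₁ D₂ U → T ∘L proj g.1 = proj g.2 ∘L T)
    {x : (H₁ →L[ℂ] H₁) × (H₂ →L[ℂ] H₂)} (hx : x ∈ pairAlgebra D₁ D₂ U) :
    T ∘L x.1 = x.2 ∘L T := by
  refine intertwiningDefect_eq_zero_iff.1 (map_eq_zero_of_forall_projection
    (R := (H₁ →L[ℂ] H₁) × (H₂ →L[ℂ] H₂)) (A := pairAlgebra D₁ D₂ U)
    isClosed_pairAlgebra hasRangeProjections_pairAlgebra (intertwiningDefect T) ?_ hx)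
  intro p hp hproj
  obtain ⟨g, rfl⟩ := exists_projPair_eq hproj
  exact intertwiningDefect_eq_zero_iff.2 (hT g hp)

end PairAlgebra

/-! ### Countable reduction by separability -/

theorem continuous_proj_apply_of_dense {ι : Type*} [TopologicalSpace ι] {u : ℕ → H}
    (hu : DenseRange u) {P : ι → Proj H} (h : ∀ n, Continuous fun i => proj (P i) (u n)) (x : H) :
    Continuous fun i => proj (P i) x := by
  refine continuous_of_uniform_approx_of_continuous fun V hV => ?_
  obtain ⟨ε, hε, hεV⟩ := Metric.mem_uniformity_dist.1 hV
  obtain ⟨n, hn⟩ := Metric.denseRange_iff.1 hu x ε hε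
  refine ⟨_, h n, fun i => hεV ?_⟩
  rw [dist_eq_norm, ← map_sub]
  refine ((P i).toSubmodule.norm_starProjection_apply_le _).trans_lt ?_
  rwa [← dist_eq_norm]

/-- `X` is given the strong operator topology, read off on dense sequences of vectors. It is second
countable, hence separable, and for fixed `T` the intertwining condition is closed in it. -/
theorem exists_seq_of_forall_intertwines [TopologicalSpace.SeparableSpace H₁]
    [TopologicalSpace.SeparableSpace H₂] {X : Set (Proj H₁ × Proj H₂)} (hX : X.Nonempty) :
    ∃ p : ℕ → Proj H₁ × Proj H₂, (∀ n, p n ∈ X) ∧ ∀ T : H₁ →L[ℂ] H₂,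
      (∀ n, T ∘L proj (p n).1 = proj (p n).2 ∘L T) →
      ∀ g ∈ X, T ∘L proj g.1 = proj g.2 ∘L T := by
  have := hX.to_subtype
  let u := TopologicalSpace.denseSeq H₁
  let v := TopologicalSpace.denseSeq H₂
  let F : X → (ℕ → H₁) × (ℕ → H₂) := fun g =>
    (fun n => proj g.1.1 (u n), fun n => proj g.1.2 (v n))
  let _ : TopologicalSpace X := TopologicalSpace.induced F inferInstance
  have : SecondCountableTopology H₁ := UniformSpace.secondCountable_of_separable H₁
  have : SecondCountableTopology H₂ := UniformSpace.secondCountable_of_separable H₂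
  have : SecondCountableTopology X :=
    TopologicalSpace.secondCountableTopology_induced X ((ℕ → H₁) × (ℕ → H₂)) F
  have hF : Continuous F := continuous_induced_dom
  refine ⟨fun n => TopologicalSpace.denseSeq X n, fun n => Subtype.coe_prop _, ?_⟩
  intro T hT g hg
  have h1 : ∀ x, Continuous fun i : X => proj i.1.1 x :=
    continuous_proj_apply_of_dense (TopologicalSpace.denseRange_denseSeq H₁)
      fun n => (continuous_apply n).comp (continuous_fst.comp hF)
  have h2 : ∀ x, Continuous fun i : X => proj i.1.2 x :=
    continuous_proj_apply_of_dense (TopologicalSpace.denseRange_denseSeq H₂)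
      fun n => (continuous_apply n).comp (continuous_snd.comp hF)
  ext x
  have h3 : (fun i : X => T (proj i.1.1 x)) = fun i : X => proj i.1.2 (T x) :=
    (TopologicalSpace.denseRange_denseSeq X).equalizer (T.continuous.comp (h1 x)) (h2 (T x))
      (funext fun n => congr($(hT n) x))
  exact congr($h3 ⟨g, hg⟩)

end NormalizingSpace

/-! ### From the pair algebra to nests -/

namespace NormalizingSpace

variable {H₁ H₂ : Type*}
  [NormedAddCommGroup H₁] [InnerProductSpace ℂ H₁] [CompleteSpace H₁]
  [NormedAddCommGroup H₂] [InnerProductSpace ℂ H₂] [CompleteSpace H₂]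
  {D₁ : StarSubalgebra ℂ (H₁ →L[ℂ] H₁)} {D₂ : StarSubalgebra ℂ (H₂ →L[ℂ] H₂)}
  {U : Submodule ℂ (H₁ →L[ℂ] H₂)}

open ContinuousLinearMap (adjoint)

theorem proj_top : proj (⊤ : Proj H₁) = 1 := by
  ext x
  exact Submodule.starProjection_eq_self_iff.2 Submodule.mem_top

theorem proj_bot : proj (⊥ : Proj H₁) = 0 := by
  ext x
  exact (Submodule.mem_bot ℂ).1 (Submodule.starProjection_apply_mem _ x)

theorem projPair_mem_pairAlgebra_iff {V : Set (H₁ →L[ℂ] H₂)} {g : Proj H₁ × Proj H₂} :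
    projPair g ∈ pairAlgebra D₁ D₂ V ↔ (∀ d ∈ D₁, d ∘L proj g.1 = proj g.1 ∘L d) ∧
      (∀ d ∈ D₂, d ∘L proj g.2 = proj g.2 ∘L d) ∧ ∀ S ∈ V, S ∘L proj g.1 = proj g.2 ∘L S := by
  rw [mem_pairAlgebra_iff]
  exact and_congr
    (forall₂_congr fun _ _ => projPair_mem_intertwinerAlgebra_iff (g := (g.1, g.1)))
    (and_congr (forall₂_congr fun _ _ => projPair_mem_intertwinerAlgebra_iff (g := (g.2, g.2)))
      (forall₂_congr fun _ _ => projPair_mem_intertwinerAlgebra_iff))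

/-- A subspace invariant under a selfadjoint family of operators reduces all of them. -/
theorem comp_proj_eq_of_mapsTo {H : Type*} [NormedAddCommGroup H] [InnerProductSpace ℂ H]
    [CompleteSpace H] {D : StarSubalgebra ℂ (H →L[ℂ] H)} {P : Proj H}
    (h : ∀ d ∈ D, ∀ x ∈ P, d x ∈ P) : ∀ d ∈ D, d ∘L proj P = proj P ∘L d := fun d hd =>
  comp_proj_eq_iff.2 ⟨h d hd, mapsTo_adjoint_iff.1 (h _ (star_mem hd))⟩

theorem IsBimodule.comp_left_mem (hU : IsBimodule D₁ D₂ U) {d : H₂ →L[ℂ] H₂} (hd : d ∈ D₂)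
    {T : H₁ →L[ℂ] H₂} (hT : T ∈ U) : d ∘L T ∈ U := hU d hd T hT 1 (one_mem D₁)

theorem IsBimodule.comp_right_mem (hU : IsBimodule D₁ D₂ U) {d : H₁ →L[ℂ] H₁} (hd : d ∈ D₁)
    {T : H₁ →L[ℂ] H₂} (hT : T ∈ U) : T ∘L d ∈ U := hU 1 (one_mem D₂) T hT d hd

theorem projPair_kerProj_mem (hU : IsBimodule D₁ D₂ U) :
    projPair (kerProj (U : Set (H₁ →L[ℂ] H₂)), ⊥) ∈
      pairAlgebra D₁ D₂ (U : Set (H₁ →L[ℂ] H₂)) := by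
  rw [projPair_mem_pairAlgebra_iff]
  refine ⟨comp_proj_eq_of_mapsTo fun d hd x hx => ?_,
    comp_proj_eq_of_mapsTo fun d hd x hx => ?_, fun S hS => ?_⟩
  · rw [mem_kerProj] at hx ⊢
    exact fun S hS => hx _ (hU.comp_right_mem hd hS)
  · rw [ClosedSubmodule.mem_bot] at hx ⊢
    rw [hx, map_zero]
  · rw [comp_proj_eq_iff]
    refine ⟨fun x hx => ?_, fun x _ => ?_⟩
    · exact mem_kerProj.1 hx S hS
    · rw [ClosedSubmodule.bot_orthogonal_eq_top]
      exact ClosedSubmodule.mem_top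

theorem projPair_rangeProj_mem (hU : IsBimodule D₁ D₂ U) :
    projPair (⊤, rangeProj U) ∈ pairAlgebra D₁ D₂ (U : Set (H₁ →L[ℂ] H₂)) := by
  rw [projPair_mem_pairAlgebra_iff]
  refine ⟨comp_proj_eq_of_mapsTo fun d hd x hx => ClosedSubmodule.mem_top,
    comp_proj_eq_of_mapsTo fun d hd x hx => ?_, fun S hS => ?_⟩
  · have : rangeProj U ≤ ClosedSubmodule.comap d (rangeProj U) := rangeProj_le fun S hS z =>
      apply_mem_rangeProj (hU.comp_left_mem hd hS) z
    exact this hx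
  · rw [comp_proj_eq_iff]
    refine ⟨fun x _ => apply_mem_rangeProj hS x, fun x hx => ?_⟩
    rw [ClosedSubmodule.top_orthogonal_eq_bot, ClosedSubmodule.mem_bot] at hx
    rw [hx, map_zero]
    exact zero_mem _

open scoped IsMulCommutative in
theorem exists_nests_of_pairAlgebra [TopologicalSpace.SeparableSpace H₁]
    [TopologicalSpace.SeparableSpace H₂] (hD₁ : IsMasa D₁) (hD₂ : IsMasa D₂)
    (hU : IsBimodule D₁ D₂ U)
    (hgen : ∀ T : H₁ →L[ℂ] H₂,
      (∀ x ∈ pairAlgebra D₁ D₂ (U : Set (H₁ →L[ℂ] H₂)), T ∘L x.1 = x.2 ∘L T) → T ∈ U) :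
    ∃ (N₁ : Set (Proj H₁)) (N₂ : Set (Proj H₂)), IsNest N₁ ∧ IsNest N₂ ∧
      ∃ φ ∈ projMapBetween N₁ N₂, U = Op φ ⊓ Op (perp φ) := by
  set A := pairAlgebra D₁ D₂ (U : Set (H₁ →L[ℂ] H₂))
  have hcomm : IsMulCommutative A := isMulCommutative_pairAlgebra hD₁ hD₂
  have hstar : ∀ {g} (hg : projPair g ∈ A), IsStarProjection (⟨projPair g, hg⟩ : A) :=
    fun {g} hg => ⟨Subtype.ext (isStarProjection_projPair g).isIdempotentElem,
      Subtype.ext (isStarProjection_projPair g).isSelfAdjoint⟩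
  let c : A := ⟨_, projPair_kerProj_mem hU⟩
  let d : A := ⟨_, projPair_rangeProj_mem hU⟩
  have hcd : c * d = c := Subtype.ext (Prod.ext
    (by simp [c, d, projPair, proj_top]) (by simp [c, d, projPair, proj_bot]))
  obtain ⟨p, hpA, hp⟩ := exists_seq_of_forall_intertwines (X := {g | projPair g ∈ A})
    ⟨_, projPair_rangeProj_mem hU⟩
  obtain ⟨C, hC, hCtotal, hcC, hdC, hCgen⟩ := exists_chain_of_projections
    (hstar (projPair_kerProj_mem hU)) (hstar (projPair_rangeProj_mem hU)) hcd
    (p := fun n => ⟨projPair (p n), hpA n⟩) fun n => hstar (hpA n)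
  have hle : ∀ {g g'} (hg : projPair g ∈ A) (hg' : projPair g' ∈ A),
      (⟨projPair g, hg⟩ : A) * ⟨projPair g', hg'⟩ = ⟨projPair g, hg⟩ → g ≤ g' := by
    intro g g' hg hg' h
    rw [mul_comm] at h
    have h' : projPair g' * projPair g = projPair g := congr(Subtype.val $h)
    exact ⟨le_of_proj_mul_eq congr(Prod.fst $h'), le_of_proj_mul_eq congr(Prod.snd $h')⟩
  refine exists_nests_of_chain (C := {g | ∃ hg : projPair g ∈ A, (⟨projPair g, hg⟩ : A) ∈ C})
    ?_ ?_ ?_ ?_ fun T hT => hgen T fun x hx => comp_fst_eq_of_forall_projPair ?_ hx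
  · rintro g ⟨hg, -⟩
    exact (projPair_mem_pairAlgebra_iff.1 hg).2.2
  · rintro g ⟨hg, hgC⟩ g' ⟨hg', hgC'⟩ _
    exact (hCtotal _ hgC _ hgC').imp (hle hg hg') (hle hg' hg)
  · rintro g ⟨hg, hgC⟩
    exact (hle _ hg (hC _ hgC).2.1).1
  · rintro g ⟨hg, hgC⟩
    exact (hle hg _ (hC _ hgC).2.2).2
  -- The elements of `A` intertwined by `T` form an additive group containing the chain, hence
  -- containing `pₙ(d - c)`. Intertwining `c` and `d` means that `T` kills the common kernel and has
  -- range in `rangeProj U`, which removes the factor `d - c`.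
  · refine hp T fun n => ?_
    let M : AddSubgroup A :=
      ((intertwiningDefect T).toLinearMap.toAddMonoidHom.comp
        (A.toSubalgebra.toSubmodule.subtype.toAddMonoidHom)).ker
    have hM : ∀ x : A, x ∈ M ↔ T ∘L x.1.1 = x.1.2 ∘L T := fun x =>
      intertwiningDefect_eq_zero_iff
    have hCM : C ⊆ M := by
      intro x hx
      obtain ⟨g, hg⟩ := exists_projPair_eq (p := x.1)
        ⟨congr(Subtype.val $((hC x hx).1.isIdempotentElem)),
          congr(Subtype.val $((hC x hx).1.isSelfAdjoint))⟩
      rw [SetLike.mem_coe, hM, ← hg]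
      refine hT g ⟨hg ▸ x.2, ?_⟩
      convert hx
    have h1 := (hM _).1 (hCM hcC)
    have h2 := (hM _).1 (hCM hdC)
    have h3 := (hM _).1 (hCgen M hCM n)
    have h4 : proj (p n).1 * proj (kerProj (U : Set (H₁ →L[ℂ] H₂))) =
        proj (kerProj (U : Set (H₁ →L[ℂ] H₂))) * proj (p n).1 :=
      congr(Prod.fst (Subtype.val $(mul_comm (⟨_, hpA n⟩ : A) c)))
    ext x
    have e1 : ∀ y, T (proj (kerProj (U : Set (H₁ →L[ℂ] H₂))) y) = 0 := fun y => by
      simpa [projPair, proj_top, proj_bot] using congr($h1 y)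
    have e2 : ∀ y, T y = proj (rangeProj U) (T y) := fun y => by
      simpa [projPair, proj_top, proj_bot] using congr($h2 y)
    have e3 := congr($h3 x)
    have e4 := congr($h4 x)
    simp only [mul_apply_eq_comp] at e4
    simp [projPair, proj_top, proj_bot, e4, e1, ← e2] at e3
    simpa using e3

end NormalizingSpace

/-! ### Amplifications and their matrix entries -/

namespace NormalizingSpace

open ContinuousLinearMap (adjoint)
open scoped ENNReal

universe u v

section Amplification

/-- The Hilbert sum of copies of `H` indexed by `ι`. -/
abbrev Copies (ι H : Type*) [NormedAddCommGroup H] : Type _ := lp (fun _ : ι => H) 2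

section Norm

variable {ι H : Type*} [NormedAddCommGroup H]

theorem summable_norm_sq (x : Copies ι H) : Summable fun i => ‖x i‖ ^ 2 := by
  simpa using (lp.memℓp x).summable (by norm_num)

theorem norm_sq_eq_tsum (x : Copies ι H) : ‖x‖ ^ 2 = ∑' i, ‖x i‖ ^ 2 := by
  simpa using lp.norm_rpow_eq_tsum (p := 2) (by norm_num) x

theorem memℓp_two_of_summable {f : ι → H} (hf : Summable fun i => ‖f i‖ ^ 2) :
    Memℓp f (2 : ℝ≥0∞) := memℓp_gen (by simpa using hf)

end Norm

variable {ι κ H K L : Type*}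
  [NormedAddCommGroup H] [InnerProductSpace ℂ H]
  [NormedAddCommGroup K] [InnerProductSpace ℂ K]
  [NormedAddCommGroup L] [InnerProductSpace ℂ L]

theorem summable_norm_sq_comp (S : H →L[ℂ] K) (x : Copies ι H) :
    Summable fun i => ‖S (x i)‖ ^ 2 := by
  refine .of_nonneg_of_le (fun _ => by positivity) (fun i => ?_)
    ((summable_norm_sq x).mul_left (‖S‖ ^ 2))
  rw [← mul_pow]
  gcongr
  exact S.le_opNorm _

/-- The operator acting as `S` on each summand. -/
noncomputable def amplify (ι : Type*) (S : H →L[ℂ] K) : Copies ι H →L[ℂ] Copies ι K :=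
  LinearMap.mkContinuous
    { toFun x := ⟨fun i => S (x i), memℓp_two_of_summable (summable_norm_sq_comp S x)⟩
      map_add' x y := by ext i; exact map_add S _ _
      map_smul' c x := by ext i; exact map_smul S _ _ } ‖S‖ fun x => by
    refine (sq_le_sq₀ (norm_nonneg _) (by positivity)).1 ?_
    rw [mul_pow, norm_sq_eq_tsum, norm_sq_eq_tsum x, ← tsum_mul_left]
    refine (summable_norm_sq_comp S x).tsum_le_tsum (fun i => ?_)
      ((summable_norm_sq x).mul_left (‖S‖ ^ 2))
    rw [← mul_pow]
    gcongr
    exact S.le_opNorm _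

@[simp]
theorem amplify_apply (S : H →L[ℂ] K) (x : Copies ι H) (i : ι) : amplify ι S x i = S (x i) := rfl

/-- Restriction of a family along an injective map of index types. -/
noncomputable def reindexCopies (e : κ → ι) (he : Function.Injective e) :
    Copies ι H →L[ℂ] Copies κ H :=
  LinearMap.mkContinuous
    { toFun x := ⟨fun k => x (e k),
        memℓp_two_of_summable ((summable_norm_sq x).comp_injective he)⟩
      map_add' x y := rfl
      map_smul' c x := rfl } 1 fun x => by
    refine (sq_le_sq₀ (norm_nonneg _) (by positivity)).1 ?_
    rw [one_mul, norm_sq_eq_tsum, norm_sq_eq_tsum x]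
    exact tsum_comp_le_tsum_of_inj (summable_norm_sq x) (fun _ => by positivity) he

/-- The linear map `S ↦ (S x_i)_i`. -/
noncomputable def amplifyAt (x : Copies ι H) : (H →L[ℂ] K) →ₗ[ℂ] Copies ι K where
  toFun S := amplify ι S x
  map_add' _ _ := rfl
  map_smul' _ _ := rfl

/-- The closure of the orbit of `x` under a space of operators. -/
noncomputable def orbitProj (W : Submodule ℂ (H →L[ℂ] K)) (x : Copies ι H) : Proj (Copies ι K) :=
  (W.map (amplifyAt x)).closure

theorem amplify_mem_orbitProj {W : Submodule ℂ (H →L[ℂ] K)} (x : Copies ι H) {S : H →L[ℂ] K}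
    (hS : S ∈ W) : amplify ι S x ∈ orbitProj W x :=
  subset_closure (Submodule.mem_map_of_mem hS)

theorem amplify_mapsTo_orbitProj {W : Submodule ℂ (H →L[ℂ] K)} {W' : Submodule ℂ (H →L[ℂ] L)}
    {A : K →L[ℂ] L} (h : ∀ S ∈ W, A ∘L S ∈ W') (x : Copies ι H) :
    ∀ z ∈ orbitProj W x, amplify ι A z ∈ orbitProj W' x := by
  have : orbitProj W x ≤ ClosedSubmodule.comap (amplify ι A) (orbitProj W' x) := by
    refine Submodule.closure_le.2 ?_
    rintro _ ⟨S, hS, rfl⟩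
    exact amplify_mem_orbitProj x (h S hS)
  exact fun z hz => this hz

/-- The `(i, j)` entry of an operator between Hilbert sums. -/
noncomputable def entry [DecidableEq ι] (i j : ι) (A : Copies ι H →L[ℂ] Copies ι K) : H →L[ℂ] K :=
  lp.evalCLM ℂ (fun _ => K) 2 i ∘L A ∘L lp.singleContinuousLinearMap ℂ (fun _ => H) 2 j

theorem entry_apply [DecidableEq ι] (i j : ι) (A : Copies ι H →L[ℂ] Copies ι K) (v : H) :
    entry i j A v = A (lp.single 2 j v) i := rfl

theorem amplify_single [DecidableEq ι] (S : H →L[ℂ] K) (j : ι) (v : H) :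
    amplify ι S (lp.single 2 j v) = lp.single 2 j (S v) := by
  ext i
  rw [amplify_apply]
  by_cases h : i = j
  · subst h; rw [lp.single_apply_self, lp.single_apply_self]
  · rw [lp.single_apply_ne _ _ _ h, lp.single_apply_ne _ _ _ h, map_zero]

theorem entry_amplify_comp [DecidableEq ι] (i j : ι) (S : K →L[ℂ] L)
    (A : Copies ι H →L[ℂ] Copies ι K) : entry i j (amplify ι S ∘L A) = S ∘L entry i j A := rfl

theorem entry_comp_amplify [DecidableEq ι] (i j : ι) (S : H →L[ℂ] K)
    (A : Copies ι K →L[ℂ] Copies ι L) : entry i j (A ∘L amplify ι S) = entry i j A ∘L S := by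
  ext v
  rw [entry_apply, ContinuousLinearMap.comp_apply, amplify_single]
  rfl

theorem eq_of_forall_entry_eq [DecidableEq ι] {A B : Copies ι H →L[ℂ] Copies ι K}
    (h : ∀ i j, entry i j A = entry i j B) : A = B := by
  refine lp.ext_continuousLinearMap (by norm_num) fun j => ?_
  ext v i
  exact congr($(h i j) v)

/-- Each functional defining the w*-topology is a matrix coefficient of the countable amplification.
-/
theorem wstarTopology_eq_induced : wstarTopology H K =
    TopologicalSpace.induced (fun (T : H →L[ℂ] K) (a : Copies ℕ H × Copies ℕ K) =>
      inner ℂ a.2 (amplify ℕ T a.1)) Pi.topologicalSpace := by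
  simp only [wstarTopology, Pi.topologicalSpace, induced_iInf, induced_compose, iInf_prod]
  rfl

variable [CompleteSpace H] [CompleteSpace K]

theorem adjoint_amplify (S : H →L[ℂ] K) : adjoint (amplify ι S) = amplify ι (adjoint S) := by
  symm
  rw [ContinuousLinearMap.eq_adjoint_iff]
  intro x y
  rw [lp.inner_eq_tsum, lp.inner_eq_tsum]
  simp only [amplify_apply, ContinuousLinearMap.adjoint_inner_left]

theorem star_entry [DecidableEq ι] (i j : ι) (A : Copies ι H →L[ℂ] Copies ι H) :
    star (entry i j A) = entry j i (star A) := by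
  refine ((ContinuousLinearMap.eq_adjoint_iff _ _).2 fun x y => ?_).symm
  rw [entry_apply, entry_apply, ← lp.inner_single_right (𝕜 := ℂ) (G := fun _ : ι => H),
    ← lp.inner_single_left (𝕜 := ℂ) (G := fun _ : ι => H), ContinuousLinearMap.star_eq_adjoint,
    ContinuousLinearMap.adjoint_inner_left]

/-- As projections are selfadjoint, the adjoint of the `(i, j)` entry is the `(j, i)` entry, so the
relation for adjoints is the same relation at the transposed position. -/
theorem entry_mem_intertwinerAlgebra [DecidableEq ι] {S : H →L[ℂ] K} {P : Proj (Copies ι H)}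
    {Q : Proj (Copies ι K)} (h : amplify ι S ∘L proj P = proj Q ∘L amplify ι S) (i j : ι) :
    (entry i j (proj P), entry i j (proj Q)) ∈ intertwinerAlgebra S := by
  have key : ∀ i j, S ∘L entry i j (proj P) = entry i j (proj Q) ∘L S := fun i j => by
    rw [← entry_amplify_comp, h, entry_comp_amplify]
  refine ⟨key i j, ?_⟩
  simp only [star_entry]
  rw [(isSelfAdjoint_starProjection P.toSubmodule).star_eq,
    (isSelfAdjoint_starProjection Q.toSubmodule).star_eq]
  exact key j i

theorem amplify_comp_proj_of_entry [DecidableEq ι] {T : H →L[ℂ] K} {P : Proj (Copies ι H)}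
    {Q : Proj (Copies ι K)} (h : ∀ i j, T ∘L entry i j (proj P) = entry i j (proj Q) ∘L T) :
    amplify ι T ∘L proj P = proj Q ∘L amplify ι T := by
  refine eq_of_forall_entry_eq fun i j => ?_
  rw [entry_amplify_comp, entry_comp_amplify, h]

end Amplification

/-! ### The double commutant argument and the theorem -/

variable {H₁ H₂ : Type*}
  [NormedAddCommGroup H₁] [InnerProductSpace ℂ H₁] [CompleteSpace H₁]
  [NormedAddCommGroup H₂] [InnerProductSpace ℂ H₂] [CompleteSpace H₂]
  {D₁ : StarSubalgebra ℂ (H₁ →L[ℂ] H₁)} {D₂ : StarSubalgebra ℂ (H₂ →L[ℂ] H₂)}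
  {U : Submodule ℂ (H₁ →L[ℂ] H₂)}

/-- The corner `U* U + D₁` of the linking algebra of `U`. -/
noncomputable def rightCorner (D₁ : StarSubalgebra ℂ (H₁ →L[ℂ] H₁))
    (U : Submodule ℂ (H₁ →L[ℂ] H₂)) : Submodule ℂ (H₁ →L[ℂ] H₁) :=
  Submodule.span ℂ ({w | ∃ S ∈ U, ∃ R ∈ U, adjoint S ∘L R = w} ∪ D₁)

/-- This is where the triple product enters: `S (R* R')` stays in `U`, while the summand `D₁` is
handled by the bimodule property. -/
theorem comp_mem_of_mem_rightCorner (hU : IsBimodule D₁ D₂ U) (hn : IsNormalizing U)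
    {S : H₁ →L[ℂ] H₂} (hS : S ∈ U) : ∀ w ∈ rightCorner D₁ U, S ∘L w ∈ U := by
  intro w hw
  have h : rightCorner D₁ U ≤ U.comap (ContinuousLinearMap.compL ℂ H₁ H₁ H₂ S).toLinearMap := by
    refine Submodule.span_le.2 ?_
    rintro w (⟨R, hR, R', hR', rfl⟩ | hw)
    · exact hn S hS R hR R' hR'
    · exact hU.comp_right_mem hw hS
  exact h hw

theorem comp_mem_rightCorner (hU : IsBimodule D₁ D₂ U) {d : H₁ →L[ℂ] H₁} (hd : d ∈ D₁) :
    ∀ w ∈ rightCorner D₁ U, d ∘L w ∈ rightCorner D₁ U := by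
  intro w hw
  have h : rightCorner D₁ U ≤
      (rightCorner D₁ U).comap (ContinuousLinearMap.compL ℂ H₁ H₁ H₁ d).toLinearMap := by
    refine Submodule.span_le.2 ?_
    rintro w (⟨R, hR, R', hR', rfl⟩ | hw)
    · refine Submodule.subset_span (Or.inl
        ⟨_, hU.comp_right_mem (star_mem hd) hR, R', hR', ?_⟩)
      rw [ContinuousLinearMap.adjoint_comp, ContinuousLinearMap.star_eq_adjoint,
        ContinuousLinearMap.adjoint_adjoint]
      rfl
    · exact Submodule.subset_span (Or.inr (mul_mem hd hw))
  exact h hw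

/-- An operator intertwining the pair algebra of a normalizing bimodule lies, after
amplification, in the closure of each orbit of the bimodule. -/
theorem amplify_mem_orbitProj_of_intertwines {ι : Type*} (hU : IsBimodule D₁ D₂ U)
    (hn : IsNormalizing U) {T : H₁ →L[ℂ] H₂}
    (hT : ∀ x ∈ pairAlgebra D₁ D₂ (U : Set (H₁ →L[ℂ] H₂)), T ∘L x.1 = x.2 ∘L T)
    (x : Copies ι H₁) : amplify ι T x ∈ orbitProj U x := by
  classical
  set P := orbitProj (rightCorner D₁ U) x
  set Q := orbitProj U x
  have hS : ∀ S ∈ U, amplify ι S ∘L proj P = proj Q ∘L amplify ι S := by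
    intro S hS
    rw [comp_proj_eq_iff, ← mapsTo_adjoint_iff, adjoint_amplify]
    exact ⟨amplify_mapsTo_orbitProj (comp_mem_of_mem_rightCorner hU hn hS) x,
      amplify_mapsTo_orbitProj
        (fun R hR => Submodule.subset_span (Or.inl ⟨S, hS, R, hR, rfl⟩)) x⟩
  have hd₁ : ∀ d ∈ D₁, amplify ι d ∘L proj P = proj P ∘L amplify ι d := by
    intro d hd
    rw [comp_proj_eq_iff, ← mapsTo_adjoint_iff, adjoint_amplify]
    exact ⟨amplify_mapsTo_orbitProj (comp_mem_rightCorner hU hd) x,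
      amplify_mapsTo_orbitProj (comp_mem_rightCorner hU (star_mem hd)) x⟩
  have hd₂ : ∀ d ∈ D₂, amplify ι d ∘L proj Q = proj Q ∘L amplify ι d := by
    intro d hd
    rw [comp_proj_eq_iff, ← mapsTo_adjoint_iff, adjoint_amplify]
    exact ⟨amplify_mapsTo_orbitProj (fun S hS => hU.comp_left_mem hd hS) x,
      amplify_mapsTo_orbitProj (fun S hS => hU.comp_left_mem (star_mem hd) hS) x⟩
  have hTPQ : amplify ι T ∘L proj P = proj Q ∘L amplify ι T :=
    amplify_comp_proj_of_entry fun i j => hT (entry i j (proj P), entry i j (proj Q))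
      (mem_pairAlgebra_iff.2 ⟨fun d hd => entry_mem_intertwinerAlgebra (hd₁ d hd) i j,
        fun d hd => entry_mem_intertwinerAlgebra (hd₂ d hd) i j,
        fun S h => entry_mem_intertwinerAlgebra (hS S h) i j⟩)
  -- The summand `D₁` of the corner contains the identity, which puts `x` itself in `P`.
  have hx : x ∈ P := amplify_mem_orbitProj (S := 1) x (Submodule.subset_span (Or.inr (one_mem D₁)))
  exact (comp_proj_eq_iff.1 hTPQ).1 x hx

/-- A w*-closed space of operators contains every operator which lies, after amplification, in
the closure of each orbit. -/
theorem IsWStarClosed.mem_of_amplify_mem {H₁ : Type u} {H₂ : Type v}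
    [NormedAddCommGroup H₁] [InnerProductSpace ℂ H₁]
    [NormedAddCommGroup H₂] [InnerProductSpace ℂ H₂]
    {U : Submodule ℂ (H₁ →L[ℂ] H₂)} (hcl : IsWStarClosed U) {T : H₁ →L[ℂ] H₂}
    (hT : ∀ (ι : Type (max u v)) (x : Copies ι H₁), amplify ι T x ∈ orbitProj U x) : T ∈ U := by
  by_contra hTU
  have hop := (@isOpen_compl_iff _ _ (wstarTopology H₁ H₂)).2 hcl
  rw [wstarTopology_eq_induced, isOpen_induced_iff] at hop
  obtain ⟨V, hV, hVU⟩ := hop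
  have hTV : T ∈ (fun (T : H₁ →L[ℂ] H₂) (a : Copies ℕ H₁ × Copies ℕ H₂) =>
      inner ℂ a.2 (amplify ℕ T a.1)) ⁻¹' V := by
    rw [hVU]; exact hTU
  obtain ⟨I, u, hu, hIV⟩ := isOpen_pi_iff.1 hV _ hTV
  -- A basic w*-neighbourhood involves finitely many functionals. Concatenating their vectors into
  -- one `x` lets a single sequence from `U` approximate `T` for all of them at once.
  let x : Copies (I × ℕ) H₁ := ⟨fun k => k.1.1.1 k.2, memℓp_two_of_summable (by
    rw [summable_prod_of_nonneg fun _ => by positivity]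
    exact ⟨fun a => summable_norm_sq a.1.1, .of_finite⟩)⟩
  obtain ⟨z, hz, hlim⟩ := mem_closure_iff_seq_limit.1 (hT _ x)
  choose S hSU hSz using hz
  have hev : ∀ a ∈ I, ∀ᶠ n in Filter.atTop, inner ℂ a.2 (amplify ℕ (S n) a.1) ∈ u a := by
    intro a ha
    have hinj : Function.Injective fun n : ℕ => ((⟨a, ha⟩, n) : I × ℕ) :=
      fun m n h => congr(Prod.snd $h)
    have h1 : Filter.Tendsto (fun n => reindexCopies _ hinj (z n)) Filter.atTop
        (nhds (reindexCopies _ hinj (amplify (I × ℕ) T x))) :=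
      ((reindexCopies _ hinj).continuous.tendsto _).comp hlim
    have h2 : ∀ R : H₁ →L[ℂ] H₂, reindexCopies _ hinj (amplify (I × ℕ) R x) = amplify ℕ R a.1 :=
      fun R => rfl
    have h3 : ∀ n, reindexCopies _ hinj (z n) = amplify ℕ (S n) a.1 := fun n => by
      rw [← hSz n]; rfl
    simp only [h2, h3] at h1
    exact ((tendsto_const_nhds (x := a.2)).inner h1).eventually ((hu a ha).1.mem_nhds (hu a ha).2)
  obtain ⟨n, hn⟩ := ((Filter.eventually_all_finset I).2 hev).exists
  have hmem : S n ∈ (U : Set (H₁ →L[ℂ] H₂))ᶜ := by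
    rw [← hVU]
    exact hIV fun a ha => hn a ha
  exact hmem (hSU n)

end NormalizingSpace

theorem theorem3p1 {H₁ H₂ : Type*}
    [NormedAddCommGroup H₁] [InnerProductSpace ℂ H₁] [CompleteSpace H₁]
    [TopologicalSpace.SeparableSpace H₁]
    [NormedAddCommGroup H₂] [InnerProductSpace ℂ H₂] [CompleteSpace H₂]
    [TopologicalSpace.SeparableSpace H₂]
    (D₁ : StarSubalgebra ℂ (H₁ →L[ℂ] H₁)) (hD₁ : NormalizingSpace.IsMasa D₁)
    (D₂ : StarSubalgebra ℂ (H₂ →L[ℂ] H₂)) (hD₂ : NormalizingSpace.IsMasa D₂)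
    (U : Submodule ℂ (H₁ →L[ℂ] H₂))
    (hU : NormalizingSpace.IsBimodule D₁ D₂ U)
    (hcl : NormalizingSpace.IsWStarClosed U) :
    NormalizingSpace.IsNormalizing U ↔
      ∃ (N₁ : Set (NormalizingSpace.Proj H₁)) (N₂ : Set (NormalizingSpace.Proj H₂)),
        NormalizingSpace.IsNest N₁ ∧ NormalizingSpace.IsNest N₂ ∧
          ∃ φ ∈ NormalizingSpace.projMapBetween N₁ N₂,
            U = NormalizingSpace.Op φ ⊓ NormalizingSpace.Op (NormalizingSpace.perp φ) := by
  constructor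
  · intro hn
    exact NormalizingSpace.exists_nests_of_pairAlgebra hD₁ hD₂ hU fun T hT =>
      hcl.mem_of_amplify_mem fun _ x =>
        NormalizingSpace.amplify_mem_orbitProj_of_intertwines hU hn hT x
  · rintro ⟨_, _, _, _, φ, _, rfl⟩
    exact NormalizingSpace.isNormalizing_Op_inf_Op_perp φ
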